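/- A \emph{$G$-Banach space} is a real Banach space $X$ with a continuous action $G\times X\to X$ of a topological group $G$ by linear isometries. Topological groups are assumed Hausdorff. Let $(\Omega,\Sigma,\mu)$ be a finite measure space. A \emph{regular set isomorphism} of it is a map $T:\Sigma\to\Sigma$ such that, modulo null sets, $T(\Omega\setminus A)=T\Omega\setminus TA$, $T(\bigcup_n A_n)=\bigcup_n TA_n$ for disjoint $A_n\in\Sigma$, and $\mu(TA)=0$ if and only if $\mu(A)=0$. An action of $G$ on $(\Omega,\Sigma,\mu)$ by regular set isomorphisms, $(g,A)\mapsto gA$, satisfies $1A=A$ and $(gh)A=g(hA)$ modulo null sets. Put $g_*\mu(A):=\mu(g^{-1}A)$, a finite measure with $g_*\mu\ll\mu$. The action induces linear isometries $U_g$ of $L_1(\mu)$ determined by $U_g(\chi_A)=\frac{dg_*\mu}{d\mu}\chi_{gA}$ for $A\in\Sigma$, and it is called \emph{continuous} if $g\mapsto U_g f$ is norm continuous for every $f\in L_1(\mu)$. Let $m:\Sigma\to X$ be a countably additive vector measure of bounded variation $|m|$ with $|m|\ll\mu$, and let $T_m(h)=\int h\,dm$ ($h\in L_1(|m|)$) be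 the continuous linear extension of $\chi_A\mapsto m(A)$. Then $m$ is \emph{$G$-quasi-invariant} if for all $g\in G$, $A\in\Sigma$ one has $\frac{dg_*\mu}{d\mu}\chi_{gA}\in L_1(|m|)$ and $g\cdot m(A)=T_m\big(\frac{dg_*\mu}{d\mu}\chi_{gA}\big)$. The $G$-Banach space $X$ \emph{has the $G$-RNP with respect to $(\Omega,\Sigma,\mu)$} if for every continuous action of $G$ on $(\Omega,\Sigma,\mu)$ by regular set isomorphisms and every $G$-quasi-invariant vector measure $m:\Sigma\to X$ of bounded variation with $|m|\ll\mu$ there is $f\in L_1(\Omega,\Sigma,\mu;X)$ with $m(A)=\int_A f\,d\mu$ for all $A\in\Sigma$. It \emph{has the $G$-RNP} if it has the $G$-RNP with respect to every finite measure space. \textbf{Corollary.} Let $G$ be a locally compact, $\sigma$-compact and separable (Hausdorff) topological group, and let $X$ be a $G$-Banach space. Then $X$ has the $G$-RNP if and only if $X$ has the $G$-RNP with respect to $([0,1],\mathcal B,\lambda)$, where $\mathcal B$ is the Borel $\sigma$-algebra and $\lambda$ is Lebesgue measure. -/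

import Mathlib

open MeasureTheory Set
open scoped ENNReal

universe w u v

/-- A set map `T` sending measurable subsets of `Ω₁` to measurable subsets of `Ω₂` is a
*regular set isomorphism* if, modulo null sets, it commutes with differences `Ω₁ \ A` and with
countable disjoint unions, and if it preserves and reflects null sets. Only the values of `T` on
measurable sets matter, and only modulo null sets. -/
structure IsRegularSetIso {Ω₁ Ω₂ : Type*} [MeasurableSpace Ω₁] [MeasurableSpace Ω₂]
    (μ₁ : Measure Ω₁) (μ₂ : Measure Ω₂) (T : Set Ω₁ → Set Ω₂) : Prop where
  measurableSet : ∀ A, MeasurableSet A → MeasurableSet (T A)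
  map_diff : ∀ A, MeasurableSet A → T (univ \ A) =ᵐ[μ₂] (T univ \ T A : Set Ω₂)
  map_iUnion : ∀ A : ℕ → Set Ω₁, (∀ n, MeasurableSet (A n)) →
    Pairwise (fun i j => Disjoint (A i) (A j)) → T (⋃ n, A n) =ᵐ[μ₂] (⋃ n, T (A n) : Set Ω₂)
  null_iff : ∀ A, MeasurableSet A → (μ₂ (T A) = 0 ↔ μ₁ A = 0)

/-- An action of a group `G` on a measure space `(Ω, μ)` by regular set isomorphisms: a
homomorphism from `G` to the group of regular set isomorphisms of `(Ω, μ)`, all set equalities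
being modulo null sets. -/
structure RegularSetAction (G : Type*) [Group G] {Ω : Type*} [MeasurableSpace Ω]
    (μ : Measure Ω) where
  act : G → Set Ω → Set Ω
  isRegularSetIso : ∀ g, IsRegularSetIso μ μ (act g)
  act_one : ∀ A, MeasurableSet A → act 1 A =ᵐ[μ] A
  act_mul : ∀ g h A, MeasurableSet A → act (g * h) A =ᵐ[μ] act g (act h A)

namespace IsRegularSetIso

variable {Ω₁ Ω₂ : Type*} [MeasurableSpace Ω₁] [MeasurableSpace Ω₂]
  {μ₁ : Measure Ω₁} {μ₂ : Measure Ω₂} {T : Set Ω₁ → Set Ω₂}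

theorem measure_empty (hT : IsRegularSetIso μ₁ μ₂ T) : μ₂ (T ∅) = 0 :=
  (hT.null_iff ∅ MeasurableSet.empty).2 (by simp)

theorem map_union (hT : IsRegularSetIso μ₁ μ₂ T) {A B : Set Ω₁} (hA : MeasurableSet A)
    (hB : MeasurableSet B) (hAB : Disjoint A B) :
    T (A ∪ B) =ᵐ[μ₂] (T A ∪ T B : Set Ω₂) := by
  let S : ℕ → Set Ω₁ := fun n => if n = 0 then A else if n = 1 then B else ∅
  have hS : ⋃ n, S n = A ∪ B := by
    ext x
    simp only [mem_iUnion, S, mem_union]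
    constructor
    · rintro ⟨n, hn⟩
      split_ifs at hn with h0 h1
      · exact Or.inl hn
      · exact Or.inr hn
      · exact absurd hn (by simp)
    · rintro (h | h)
      · exact ⟨0, by simpa using h⟩
      · exact ⟨1, by simpa using h⟩
  have hSm : ∀ n, MeasurableSet (S n) := by
    intro n
    simp only [S]
    split_ifs <;> simp [hA, hB]
  have hSd : Pairwise (fun i j => Disjoint (S i) (S j)) := by
    intro i j hij
    simp only [S]
    split_ifs <;> simp_all [disjoint_comm]
  have h1 := hT.map_iUnion S hSm hSd
  rw [hS] at h1
  have h2 : (⋃ n, T (S n)) =ᵐ[μ₂] (T A ∪ T B : Set Ω₂) := by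
    have h0 : ∀ᵐ x ∂μ₂, x ∉ T ∅ := measure_eq_zero_iff_ae_notMem.1 hT.measure_empty
    filter_upwards [h0] with x hx
    apply propext
    change (x ∈ ⋃ n, T (S n)) ↔ x ∈ T A ∪ T B
    simp only [mem_iUnion, S, mem_union]
    constructor
    · rintro ⟨n, hn⟩
      split_ifs at hn with h0 h1
      · exact Or.inl hn
      · exact Or.inr hn
      · exact absurd hn hx
    · rintro (h | h)
      · exact ⟨0, by simpa using h⟩
      · exact ⟨1, by simpa using h⟩
  exact h1.trans h2

/-- Disjoint measurable sets have images that are disjoint modulo null sets. -/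
theorem aedisjoint (hT : IsRegularSetIso μ₁ μ₂ T) {A B : Set Ω₁} (hA : MeasurableSet A)
    (hB : MeasurableSet B) (hAB : Disjoint A B) : AEDisjoint μ₂ (T A) (T B) := by
  have hBA : B ⊆ univ \ A := fun x hx => ⟨mem_univ x, fun h => hAB.le_bot ⟨h, hx⟩⟩
  have hAc : MeasurableSet (univ \ A) := MeasurableSet.univ.diff hA
  have h1 : T (univ \ A) =ᵐ[μ₂] (T B ∪ T ((univ \ A) \ B) : Set Ω₂) := by
    have := hT.map_union hB (hAc.diff hB) disjoint_sdiff_right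
    rwa [union_sdiff_cancel hBA] at this
  have h2 := hT.map_diff A hA
  have h3 : ∀ᵐ x ∂μ₂, x ∉ T A ∩ T B := by
    filter_upwards [h1, h2] with x hx1 hx2 hx
    have e1 : x ∈ T (univ \ A) ↔ x ∈ T B ∪ T ((univ \ A) \ B) := iff_of_eq hx1
    have e2 : x ∈ T (univ \ A) ↔ x ∈ T univ \ T A := iff_of_eq hx2
    exact (e2.1 (e1.2 (Or.inl hx.2))).2 hx.1
  exact measure_eq_zero_iff_ae_notMem.2 h3

/-- A regular set isomorphism is well defined modulo null sets. -/
theorem congr_ae (hT : IsRegularSetIso μ₁ μ₂ T) {A B : Set Ω₁} (hA : MeasurableSet A)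
    (hB : MeasurableSet B) (hAB : A =ᵐ[μ₁] B) : T A =ᵐ[μ₂] T B := by
  have key : ∀ {C D : Set Ω₁}, MeasurableSet C → MeasurableSet D → C =ᵐ[μ₁] D →
      T C =ᵐ[μ₂] T (C ∩ D) := by
    intro C D hC hD hCD
    have h1 := hT.map_union (hC.inter hD) (hC.diff hD) disjoint_inf_sdiff
    rw [inter_union_sdiff] at h1
    have h2 : ∀ᵐ x ∂μ₂, x ∉ T (C \ D) := by
      refine measure_eq_zero_iff_ae_notMem.1 ((hT.null_iff _ (hC.diff hD)).2 ?_)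
      exact (ae_eq_set.1 hCD).1
    filter_upwards [h1, h2] with x hx1 hx2
    have e1 : x ∈ T C ↔ x ∈ T (C ∩ D) ∪ T (C \ D) := iff_of_eq hx1
    apply propext
    change x ∈ T C ↔ x ∈ T (C ∩ D)
    rw [e1]
    exact ⟨fun h => h.resolve_right hx2, Or.inl⟩
  have h1 := key hA hB hAB
  have h2 := key hB hA hAB.symm
  rw [inter_comm] at h2
  exact h1.trans h2.symm

end IsRegularSetIso

namespace RegularSetAction

variable {G : Type*} [Group G] {Ω : Type*} [MeasurableSpace Ω] {μ : Measure Ω}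

/-- The pushforward measure `g_* μ`, given by `g_* μ (A) = μ (g⁻¹ A)`. -/
noncomputable def pushforward (α : RegularSetAction G μ) (g : G) : Measure Ω :=
  Measure.ofMeasurable (fun A _ => μ (α.act g⁻¹ A)) (α.isRegularSetIso g⁻¹).measure_empty
    (by
      intro A hA hd
      have hT := α.isRegularSetIso g⁻¹
      rw [measure_congr (hT.map_iUnion A hA hd)]
      exact measure_iUnion₀ (fun i j hij => hT.aedisjoint (hA i) (hA j) (hd hij))
        (fun i => (hT.measurableSet _ (hA i)).nullMeasurableSet))

theorem pushforward_apply (α : RegularSetAction G μ) (g : G) {A : Set Ω}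
    (hA : MeasurableSet A) : α.pushforward g A = μ (α.act g⁻¹ A) :=
  Measure.ofMeasurable_apply A hA

theorem pushforward_act (α : RegularSetAction G μ) (g : G) {A : Set Ω}
    (hA : MeasurableSet A) : α.pushforward g (α.act g A) = μ A := by
  rw [α.pushforward_apply g ((α.isRegularSetIso g).measurableSet A hA)]
  refine measure_congr ((α.act_mul g⁻¹ g A hA).symm.trans ?_)
  rw [inv_mul_cancel]
  exact α.act_one A hA

theorem pushforward_absolutelyContinuous (α : RegularSetAction G μ) (g : G) :
    α.pushforward g ≪ μ := by
  refine Measure.AbsolutelyContinuous.mk fun A hA h0 => ?_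
  rw [α.pushforward_apply g hA]
  exact ((α.isRegularSetIso g⁻¹).null_iff A hA).2 h0

instance [IsFiniteMeasure μ] (α : RegularSetAction G μ) (g : G) :
    IsFiniteMeasure (α.pushforward g) :=
  ⟨by rw [α.pushforward_apply g MeasurableSet.univ]; exact measure_lt_top _ _⟩

/-- The Radon-Nikodym derivative `d(g_* μ)/dμ`, as a nonnegative real function. -/
noncomputable def density (α : RegularSetAction G μ) (g : G) : Ω → ℝ :=
  fun ω => ((α.pushforward g).rnDeriv μ ω).toReal

theorem integrable_density [IsFiniteMeasure μ] (α : RegularSetAction G μ) (g : G) :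
    Integrable (α.density g) μ :=
  Measure.integrable_toReal_rnDeriv

theorem integrable_indicator_density [IsFiniteMeasure μ] (α : RegularSetAction G μ) (g : G)
    {A : Set Ω} (hA : MeasurableSet A) :
    Integrable ((α.act g A).indicator (α.density g)) μ :=
  (α.integrable_density g).indicator ((α.isRegularSetIso g).measurableSet A hA)

open Classical in
/-- The class in `L¹(μ)` of `d(g_* μ)/dμ · χ_{gA}`, for measurable `A`. -/
noncomputable def imageL1 [IsFiniteMeasure μ] (α : RegularSetAction G μ) (g : G) (A : Set Ω) :
    Lp ℝ 1 μ :=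
  if hA : MeasurableSet A then (α.integrable_indicator_density g hA).toL1 _ else 0

theorem coeFn_imageL1 [IsFiniteMeasure μ] (α : RegularSetAction G μ) (g : G) {A : Set Ω}
    (hA : MeasurableSet A) :
    α.imageL1 g A =ᵐ[μ] (α.act g A).indicator (α.density g) := by
  rw [imageL1, dif_pos hA]
  exact Integrable.coeFn_toL1 _

theorem norm_imageL1 [IsFiniteMeasure μ] (α : RegularSetAction G μ) (g : G) {A : Set Ω}
    (hA : MeasurableSet A) : ‖α.imageL1 g A‖ = μ.real A := by
  have hgA := (α.isRegularSetIso g).measurableSet A hA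
  have hn : ∀ ω, 0 ≤ α.density g ω := fun ω => ENNReal.toReal_nonneg
  rw [L1.norm_eq_integral_norm]
  have h1 : (fun ω => ‖α.imageL1 g A ω‖) =ᵐ[μ] (α.act g A).indicator (α.density g) := by
    filter_upwards [α.coeFn_imageL1 g hA] with ω h
    rw [h, Real.norm_of_nonneg (indicator_nonneg (fun ω _ => hn ω) ω)]
  rw [integral_congr_ae h1, integral_indicator hgA]
  have h2 := Measure.setIntegral_toReal_rnDeriv (α.pushforward_absolutelyContinuous g)
    (α.act g A)
  rw [measureReal_def, α.pushforward_act g hA] at h2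
  exact h2

theorem dominatedFinMeasAdditive_imageL1 [IsFiniteMeasure μ] (α : RegularSetAction G μ) (g : G) :
    DominatedFinMeasAdditive μ
      (fun A => ContinuousLinearMap.toSpanSingleton ℝ (α.imageL1 g A)) 1 := by
  refine ⟨fun A B hA hB _ _ hAB => ?_, fun A hA _ => ?_⟩
  · have hT := α.isRegularSetIso g
    have h : α.imageL1 g (A ∪ B) = α.imageL1 g A + α.imageL1 g B := by
      apply Lp.ext
      have hd : ∀ᵐ x ∂μ, x ∉ α.act g A ∩ α.act g B :=
        measure_eq_zero_iff_ae_notMem.1 (hT.aedisjoint hA hB hAB)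
      filter_upwards [α.coeFn_imageL1 g (hA.union hB), α.coeFn_imageL1 g hA,
        α.coeFn_imageL1 g hB, Lp.coeFn_add (α.imageL1 g A) (α.imageL1 g B),
        hT.map_union hA hB hAB, hd] with x h1 h2 h3 h4 h5 h6
      have h5' : x ∈ α.act g (A ∪ B) ↔ x ∈ α.act g A ∪ α.act g B := iff_of_eq h5
      rw [h4, Pi.add_apply, h1, h2, h3]
      by_cases hxA : x ∈ α.act g A <;> by_cases hxB : x ∈ α.act g B
      · exact absurd ⟨hxA, hxB⟩ h6
      all_goals simp [indicator, h5', hxA, hxB]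
    ext
    simp [h]
  · rw [ContinuousLinearMap.norm_toSpanSingleton, α.norm_imageL1 g hA, one_mul]

/-- The isometry `U_g` of `L¹(μ)` induced by `g`: the continuous linear extension of
`χ_A ↦ d(g_* μ)/dμ · χ_{gA}`. -/
noncomputable def koopman [IsFiniteMeasure μ] (α : RegularSetAction G μ) (g : G) :
    Lp ℝ 1 μ →L[ℝ] Lp ℝ 1 μ :=
  L1.setToL1 (α.dominatedFinMeasAdditive_imageL1 g)

theorem koopman_indicator [IsFiniteMeasure μ] (α : RegularSetAction G μ) (g : G) {A : Set Ω}
    (hA : MeasurableSet A) :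
    α.koopman g (indicatorConstLp 1 hA (measure_ne_top μ A) (1 : ℝ)) =ᵐ[μ]
      (α.act g A).indicator (α.density g) := by
  rw [koopman, L1.setToL1_indicatorConstLp]
  simpa using α.coeFn_imageL1 g hA

/-- The action is continuous if the homomorphism `g ↦ U_g` into the linear isometries of `L¹(μ)`
is continuous for the strong operator topology. -/
def IsContinuous [TopologicalSpace G] [IsFiniteMeasure μ] (α : RegularSetAction G μ) : Prop :=
  ∀ f : Lp ℝ 1 μ, Continuous fun g => α.koopman g f

/-- An `X`-valued vector measure `m` is `G`-quasi-invariant if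
`g • m A = T_m (d(g_* μ)/dμ · χ_{gA})` for all `g` and all measurable `A`, where `T_m` is the
integration of scalar functions against `m` (the extension of `χ_A ↦ m A`), the integrand being
required to lie in its domain. -/
def IsQuasiInvariant {X : Type*} [NormedAddCommGroup X] [NormedSpace ℝ X] [SMul G X]
    (α : RegularSetAction G μ) (m : VectorMeasure Ω X) : Prop :=
  ∀ g A, MeasurableSet A →
    m.Integrable ((α.act g A).indicator (α.density g)) ∧
    g • m A = ∫ᵛ ω, (α.act g A).indicator (α.density g) ω ∂•m

end RegularSetAction

/-- The `G`-Radon-Nikodym property of `X` with respect to one finite measure space `(Ω, μ)`. -/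
def HasGRNPWith (G X : Type*) [Group G] [TopologicalSpace G]
    [NormedAddCommGroup X] [NormedSpace ℝ X] [SMul G X]
    {Ω : Type*} [MeasurableSpace Ω] (μ : Measure Ω) [IsFiniteMeasure μ] : Prop :=
  ∀ α : RegularSetAction G μ, α.IsContinuous →
    ∀ m : VectorMeasure Ω X, m.variation univ < ∞ → m.variation ≪ μ → α.IsQuasiInvariant m →
      ∃ f : Ω → X, Integrable f μ ∧ ∀ A, MeasurableSet A → m A = ∫ ω in A, f ω ∂μ

/-- The `G`-Radon-Nikodym property of `X`: with respect to every finite measure space. -/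
def HasGRNP.{z} (G X : Type*) [Group G] [TopologicalSpace G]
    [NormedAddCommGroup X] [NormedSpace ℝ X] [SMul G X] : Prop :=
  ∀ (Ω : Type z) [MeasurableSpace Ω] (μ : Measure Ω) [IsFiniteMeasure μ], HasGRNPWith G X μ

/-! The unit interval is itself a finite measure space, so one direction only needs transport along
an isomorphism. For the converse, let `G` act continuously on `(Ω, μ)` and let `m` be
quasi-invariant.

By martingale convergence in `L¹(μ; X)`, it is enough to find a density of `m` on every countably
generated sub-σ-algebra (`exists_density_of_forall_countable`). Such a σ-algebra can be enlarged to
a countably generated one that is invariant modulo null sets and to which all densities `d(g_*μ)/dμ`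
are adapted: it is closed under a countable dense subgroup of `G`, and strong continuity of `g ↦
U_g` extends the invariance to all of `G` (`exists_invariant_real_map`). The enlarged σ-algebra is
generated by one function `ψ : Ω → ℝ`.

The image measure of `ψ` has countably many atoms. The action carries atoms to atoms, because the
image of an atom cannot be split (`act_atom_le`); hence the atomless part is invariant. On the atoms
the density is a quotient of point masses. On the atomless part the distribution function gives an
isomorphism with a multiple of Lebesgue measure on the unit interval
(`exists_measurable_map_eq_smul_volume`). The action and `m` descend along it, the action staying
continuous and `m` quasi-invariant, so the hypothesis yields a density, which is pulled back to `Ω`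
(`IsFactor.exists_density`). -/

/-! ### Boolean calculus of regular set isomorphisms modulo null sets. -/

namespace IsRegularSetIso

variable {Ω₁ Ω₂ : Type*} [MeasurableSpace Ω₁] [MeasurableSpace Ω₂]
  {μ₁ : Measure Ω₁} {μ₂ : Measure Ω₂} {T : Set Ω₁ → Set Ω₂}

/-- A regular set isomorphism is monotone modulo null sets. -/
theorem mono_ae (hT : IsRegularSetIso μ₁ μ₂ T) {A B : Set Ω₁} (hA : MeasurableSet A)
    (hB : MeasurableSet B) (hAB : A ≤ᵐ[μ₁] B) : T A ≤ᵐ[μ₂] T B := by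
  have h1 : B =ᵐ[μ₁] (A ∪ B : Set Ω₁) := by
    filter_upwards [hAB] with x hx
    exact propext ⟨Or.inr, fun h => h.elim hx id⟩
  have h2 := hT.map_union hA (hB.diff hA) disjoint_sdiff_right
  rw [union_sdiff_self] at h2
  filter_upwards [hT.congr_ae hB (hA.union hB) h1, h2] with x h3 h4 hx
  exact (iff_of_eq h3).2 ((iff_of_eq h4).2 (Or.inl hx))

theorem mono (hT : IsRegularSetIso μ₁ μ₂ T) {A B : Set Ω₁} (hA : MeasurableSet A)
    (hB : MeasurableSet B) (hAB : A ⊆ B) : T A ≤ᵐ[μ₂] T B :=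
  hT.mono_ae hA hB (Filter.Eventually.of_forall fun _ h => hAB h)

theorem map_inter (hT : IsRegularSetIso μ₁ μ₂ T) {A B : Set Ω₁} (hA : MeasurableSet A)
    (hB : MeasurableSet B) : T (A ∩ B) =ᵐ[μ₂] (T A ∩ T B : Set Ω₂) := by
  have h1 := hT.map_union (hA.inter hB) (hA.diff hB) disjoint_inf_sdiff
  rw [inter_union_sdiff] at h1
  have h2 : ∀ᵐ x ∂μ₂, x ∉ T (A \ B) ∩ T B :=
    measure_eq_zero_iff_ae_notMem.1 (hT.aedisjoint (hA.diff hB) hB disjoint_sdiff_left)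
  filter_upwards [h1, h2, hT.mono (hA.inter hB) hB inter_subset_right] with x h1 h2 h3
  have h1' : x ∈ T A ↔ x ∈ T (A ∩ B) ∪ T (A \ B) := iff_of_eq h1
  refine propext ⟨fun h => ⟨h1'.2 (Or.inl h), h3 h⟩, fun h => ?_⟩
  exact (h1'.1 h.1).resolve_right fun h' => h2 ⟨h', h.2⟩

/-- A regular set isomorphism commutes with countable unions that need not be disjoint. -/
theorem map_iUnion' (hT : IsRegularSetIso μ₁ μ₂ T) {A : ℕ → Set Ω₁}
    (hA : ∀ n, MeasurableSet (A n)) : T (⋃ n, A n) =ᵐ[μ₂] (⋃ n, T (A n) : Set Ω₂) := by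
  have hd : ∀ n, MeasurableSet (disjointed A n) := fun n => MeasurableSet.disjointed hA n
  have h1 := hT.map_iUnion (disjointed A) hd (disjoint_disjointed A)
  rw [iUnion_disjointed] at h1
  have h2 : ∀ n, T (disjointed A n) ≤ᵐ[μ₂] T (A n) := fun n =>
    hT.mono (hd n) (hA n) (disjointed_subset A n)
  have h3 : ∀ n, T (A n) ≤ᵐ[μ₂] T (⋃ n, A n) := fun n =>
    hT.mono (hA n) (MeasurableSet.iUnion hA) (subset_iUnion A n)
  filter_upwards [h1, ae_all_iff.2 h2, ae_all_iff.2 h3] with x h1 h2 h3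
  refine propext ⟨fun h => ?_, fun h => ?_⟩
  · obtain ⟨n, hn⟩ := mem_iUnion.1 ((iff_of_eq h1).1 h)
    exact mem_iUnion.2 ⟨n, h2 n hn⟩
  · obtain ⟨n, hn⟩ := mem_iUnion.1 h
    exact h3 n hn

end IsRegularSetIso

/-! ### Elementary properties of actions and of their isometries. -/

namespace RegularSetAction

variable {G : Type*} [Group G] {Ω : Type*} [MeasurableSpace Ω] {μ : Measure Ω}

theorem measurableSet_act (α : RegularSetAction G μ) (g : G) {A : Set Ω}
    (hA : MeasurableSet A) : MeasurableSet (α.act g A) :=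
  (α.isRegularSetIso g).measurableSet A hA

theorem act_act_inv (α : RegularSetAction G μ) (g : G) {A : Set Ω} (hA : MeasurableSet A) :
    α.act g (α.act g⁻¹ A) =ᵐ[μ] A := by
  refine (α.act_mul g g⁻¹ A hA).symm.trans ?_
  rw [mul_inv_cancel]
  exact α.act_one A hA

theorem act_univ (α : RegularSetAction G μ) (g : G) : α.act g univ =ᵐ[μ] univ := by
  have h := (α.isRegularSetIso g).mono (α.measurableSet_act g⁻¹ MeasurableSet.univ)
    MeasurableSet.univ (subset_univ _)
  filter_upwards [h, α.act_act_inv g MeasurableSet.univ] with x h1 h2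
  exact propext ⟨fun _ => trivial, fun hx => h1 ((iff_of_eq h2).2 hx)⟩

theorem act_compl (α : RegularSetAction G μ) (g : G) {A : Set Ω} (hA : MeasurableSet A) :
    α.act g Aᶜ =ᵐ[μ] ((α.act g A)ᶜ : Set Ω) := by
  have h := (α.isRegularSetIso g).map_diff A hA
  rw [← compl_eq_univ_sdiff] at h
  filter_upwards [h, α.act_univ g] with x h1 h2
  refine propext ((iff_of_eq h1).trans ⟨fun h => h.2, fun h => ⟨?_, h⟩⟩)
  exact (iff_of_eq h2).2 trivial

/-- The reverse inclusion comes from applying `g` to `g⁻¹ A ≤ A`. -/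
theorem act_eq_of_forall_le (α : RegularSetAction G μ) {A : Set Ω} (hA : MeasurableSet A)
    (h : ∀ g, α.act g A ≤ᵐ[μ] A) (g : G) : α.act g A =ᵐ[μ] A := by
  have h1 := (α.isRegularSetIso g).mono_ae (α.measurableSet_act g⁻¹ hA) hA (h g⁻¹)
  filter_upwards [h g, h1, α.act_act_inv g hA] with x h2 h3 h4
  exact propext ⟨fun hx => h2 hx, fun hx => h3 ((iff_of_eq h4).2 hx)⟩

theorem absolutelyContinuous_pushforward (α : RegularSetAction G μ) (g : G) : μ ≪ α.pushforward g := by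
  refine Measure.AbsolutelyContinuous.mk fun A hA h0 => ?_
  rw [α.pushforward_apply g hA] at h0
  exact ((α.isRegularSetIso g⁻¹).null_iff A hA).1 h0

/-- Null sets are reflected as well as preserved, so `μ` and `g_* μ` are equivalent. Positivity
makes `g A` recoverable as the support of `U_g χ_A`. -/
theorem density_pos [IsFiniteMeasure μ] (α : RegularSetAction G μ) (g : G) :
    ∀ᵐ ω ∂μ, 0 < α.density g ω := by
  filter_upwards [Measure.rnDeriv_pos' (α.absolutelyContinuous_pushforward g),
    (α.pushforward g).rnDeriv_lt_top μ] with ω h1 h2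
  exact ENNReal.toReal_pos h1.ne' h2.ne

section Continuity

variable [IsFiniteMeasure μ]

theorem norm_koopman_le (α : RegularSetAction G μ) (g : G) : ‖α.koopman g‖ ≤ 1 :=
  L1.norm_setToL1_le _ zero_le_one

theorem koopman_indicatorConstLp (α : RegularSetAction G μ) (g : G) {A : Set Ω}
    (hA : MeasurableSet A) (c : ℝ) :
    α.koopman g (indicatorConstLp 1 hA (measure_ne_top μ A) c) =
      c • α.koopman g (indicatorConstLp 1 hA (measure_ne_top μ A) (1 : ℝ)) := by
  simp [koopman, L1.setToL1_indicatorConstLp]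

/-- Strong continuity of the isometries `U_g` may be checked on indicator functions. -/
theorem isContinuous_of_indicator [TopologicalSpace G] (α : RegularSetAction G μ)
    (h : ∀ (A : Set Ω) (hA : MeasurableSet A), Continuous fun g =>
      α.koopman g (indicatorConstLp 1 hA (measure_ne_top μ A) (1 : ℝ))) :
    α.IsContinuous := by
  intro f
  induction f using Lp.induction ENNReal.one_ne_top with
  | indicatorConst c hs hc =>
    rw [Lp.simpleFunc.coe_indicatorConst]
    simp_rw [α.koopman_indicatorConstLp _ hs c]
    exact (h _ hs).const_smul c
  | @add f g hf hg _ hf' hg' =>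
    simp_rw [map_add]
    exact hf'.add hg'
  | isClosed =>
    -- The bound `‖U_g‖ ≤ 1` does not depend on `g`, so approximating `f` in norm approximates its
    -- orbit map uniformly.
    refine isClosed_of_closure_subset fun f hf => ?_
    refine continuous_of_uniform_approx_of_continuous fun u hu => ?_
    obtain ⟨ε, hε, hu⟩ := Metric.mem_uniformity_dist.1 hu
    obtain ⟨f', hf', hd⟩ := Metric.mem_closure_iff.1 hf ε hε
    refine ⟨_, hf', fun g => hu ?_⟩
    rw [dist_eq_norm, ← map_sub]
    refine lt_of_le_of_lt ((α.koopman g).le_of_opNorm_le (α.norm_koopman_le g) _) ?_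
    rwa [one_mul, ← dist_eq_norm]

end Continuity

end RegularSetAction

/-! ### Factors of an action, and descent of the action and of vector measures to them. -/

theorem ae_restrict_eq_iff {Ω : Type*} [MeasurableSpace Ω] {μ : Measure Ω} {E A B : Set Ω}
    (hE : MeasurableSet E) :
    A =ᵐ[μ.restrict E] B ↔ (A ∩ E : Set Ω) =ᵐ[μ] (B ∩ E : Set Ω) := by
  have h : A =ᵐ[μ.restrict E] B ↔ ∀ᵐ x ∂μ, x ∈ E → (A x = B x) := ae_restrict_iff' hE
  rw [h]
  refine Filter.eventually_congr (Filter.Eventually.of_forall fun x => ?_)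
  change (x ∈ E → (x ∈ A) = (x ∈ B)) ↔ (x ∈ A ∩ E) = (x ∈ B ∩ E)
  simp only [eq_iff_iff, mem_inter_iff]
  tauto

namespace RegularSetAction

/-- The map `φ`, restricted to the invariant set `E`, exhibits `(Ω', ν)` up to the factor `c` as a
factor of `(E, μ)` on which the action is still defined and to which the densities descend. -/
structure IsFactor {G : Type*} [Group G] {Ω Ω' : Type*} [MeasurableSpace Ω] [MeasurableSpace Ω']
    {μ : Measure Ω} (α : RegularSetAction G μ) (ν : Measure Ω') (E : Set Ω) (φ : Ω → Ω')
    (c : ℝ≥0∞) : Prop where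
  measurableSet : MeasurableSet E
  measurable : Measurable φ
  act_eq : ∀ g, α.act g E =ᵐ[μ] E
  ne_zero : c ≠ 0
  ne_top : c ≠ ∞
  map_eq : (μ.restrict E).map φ = c • ν
  exists_act : ∀ g A, MeasurableSet A →
    ∃ A', MeasurableSet A' ∧ α.act g (φ ⁻¹' A) =ᵐ[μ.restrict E] φ ⁻¹' A'
  exists_rnDeriv : ∀ g, ∃ h : Ω' → ℝ≥0∞, Measurable h ∧
    (α.pushforward g).rnDeriv μ =ᵐ[μ.restrict E] h ∘ φ

variable {G : Type*} [Group G] {Ω Ω' : Type*} [MeasurableSpace Ω] [MeasurableSpace Ω']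
  {μ : Measure Ω} {α : RegularSetAction G μ} {ν : Measure Ω'} {E : Set Ω} {φ : Ω → Ω'}
  {c : ℝ≥0∞}

theorem act_congr_restrict (hE : MeasurableSet E) (hαE : ∀ g, α.act g E =ᵐ[μ] E) (g : G)
    {A B : Set Ω} (hA : MeasurableSet A) (hB : MeasurableSet B) (h : A =ᵐ[μ.restrict E] B) :
    α.act g A =ᵐ[μ.restrict E] α.act g B := by
  rw [ae_restrict_eq_iff hE] at h ⊢
  have hT := α.isRegularSetIso g
  have h1 := hT.congr_ae (hA.inter hE) (hB.inter hE) h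
  filter_upwards [h1, hT.map_inter hA hE, hT.map_inter hB hE, hαE g] with x h1 h2 h3 h4
  have h1' : x ∈ α.act g (A ∩ E) ↔ x ∈ α.act g (B ∩ E) := iff_of_eq h1
  have h2' : x ∈ α.act g (A ∩ E) ↔ x ∈ α.act g A ∩ α.act g E := iff_of_eq h2
  have h3' : x ∈ α.act g (B ∩ E) ↔ x ∈ α.act g B ∩ α.act g E := iff_of_eq h3
  have h4' : x ∈ α.act g E ↔ x ∈ E := iff_of_eq h4
  refine propext ?_
  change x ∈ α.act g A ∩ E ↔ x ∈ α.act g B ∩ E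
  simp only [mem_inter_iff] at h2' h3' ⊢
  tauto

theorem act_inter_eq (hE : MeasurableSet E) (hαE : ∀ g, α.act g E =ᵐ[μ] E) (g : G)
    {A : Set Ω} (hA : MeasurableSet A) :
    α.act g (A ∩ E) =ᵐ[μ] (α.act g A ∩ E : Set Ω) :=
  ((α.isRegularSetIso g).map_inter hA hE).trans
    (Filter.EventuallyEq.rfl.inter (hαE g))

theorem restrict_act_eq_zero_iff (hE : MeasurableSet E) (hαE : ∀ g, α.act g E =ᵐ[μ] E) (g : G)
    {A : Set Ω} (hA : MeasurableSet A) :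
    μ.restrict E (α.act g A) = 0 ↔ μ.restrict E A = 0 := by
  rw [Measure.restrict_apply (α.measurableSet_act g hA), Measure.restrict_apply hA,
    ← measure_congr (act_inter_eq hE hαE g hA)]
  exact (α.isRegularSetIso g).null_iff _ (hA.inter hE)

namespace IsFactor

theorem restrict_preimage (h : α.IsFactor ν E φ c) {A : Set Ω'} (hA : MeasurableSet A) :
    μ.restrict E (φ ⁻¹' A) = c * ν A := by
  rw [← Measure.map_apply h.measurable hA, h.map_eq]
  rfl

theorem quasiMeasurePreserving (h : α.IsFactor ν E φ c) :
    Measure.QuasiMeasurePreserving φ (μ.restrict E) ν :=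
  ⟨h.measurable, by rw [h.map_eq]; exact Measure.smul_absolutelyContinuous⟩

theorem ae_comp (h : α.IsFactor ν E φ c) {p : Ω' → Prop} (hp : ∀ᵐ y ∂ν, p y) :
    ∀ᵐ x ∂μ.restrict E, p (φ x) :=
  h.quasiMeasurePreserving.ae hp

theorem ae_of_ae_comp (h : α.IsFactor ν E φ c) {p : Ω' → Prop} (hp : MeasurableSet {y | p y})
    (hφ : ∀ᵐ x ∂μ.restrict E, p (φ x)) : ∀ᵐ y ∂ν, p y := by
  have h1 := (ae_map_iff h.measurable.aemeasurable hp).2 hφ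
  rw [h.map_eq] at h1
  exact (Measure.ae_ennreal_smul_measure_iff h.ne_zero).1 h1

/-- Pullback by `φ` is faithful modulo null sets because `c ≠ 0`. Every axiom of the induced action
is therefore verified upstairs, where it is an axiom of `α`. -/
theorem preimage_ae_eq_iff (h : α.IsFactor ν E φ c) {A B : Set Ω'} (hA : MeasurableSet A)
    (hB : MeasurableSet B) : φ ⁻¹' A =ᵐ[μ.restrict E] φ ⁻¹' B ↔ A =ᵐ[ν] B := by
  refine ⟨fun hφ => ?_, fun hAB => h.ae_comp hAB⟩
  refine h.ae_of_ae_comp (p := fun y => A y = B y) ?_ hφ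
  have : {y | A y = B y} = (A ∩ B) ∪ (Aᶜ ∩ Bᶜ) := by
    ext y
    change (y ∈ A) = (y ∈ B) ↔ _
    simp only [eq_iff_iff, mem_union, mem_inter_iff, mem_compl_iff]
    tauto
  rw [this]
  exact (hA.inter hB).union (hA.compl.inter hB.compl)

open Classical in
/-- The values of the induced action on the factor. -/
noncomputable def factorAct (h : α.IsFactor ν E φ c) (g : G) (A : Set Ω') : Set Ω' :=
  if hA : MeasurableSet A then (h.exists_act g A hA).choose else ∅

theorem measurableSet_factorAct (h : α.IsFactor ν E φ c) (g : G) {A : Set Ω'}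
    (hA : MeasurableSet A) : MeasurableSet (h.factorAct g A) := by
  rw [factorAct, dif_pos hA]
  exact (h.exists_act g A hA).choose_spec.1

theorem preimage_factorAct (h : α.IsFactor ν E φ c) (g : G) {A : Set Ω'}
    (hA : MeasurableSet A) : α.act g (φ ⁻¹' A) =ᵐ[μ.restrict E] φ ⁻¹' (h.factorAct g A) := by
  rw [factorAct, dif_pos hA]
  exact (h.exists_act g A hA).choose_spec.2

/-- The action induced on a factor. -/
noncomputable def factor (h : α.IsFactor ν E φ c) : RegularSetAction G ν where
  act := h.factorAct
  isRegularSetIso g := by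
    have hac : μ.restrict E ≪ μ := Measure.restrict_le_self.absolutelyContinuous
    refine ⟨fun A hA => h.measurableSet_factorAct g hA, fun A hA => ?_, fun A hA hd => ?_,
      fun A hA => ?_⟩
    · have hm := h.measurableSet_factorAct g (MeasurableSet.univ.diff hA)
      rw [← h.preimage_ae_eq_iff hm ((h.measurableSet_factorAct g MeasurableSet.univ).diff
        (h.measurableSet_factorAct g hA))]
      refine (h.preimage_factorAct g (MeasurableSet.univ.diff hA)).symm.trans ?_
      have h1 := hac.ae_eq ((α.isRegularSetIso g).map_diff (φ ⁻¹' A) (h.measurable hA))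
      exact h1.trans ((h.preimage_factorAct g MeasurableSet.univ).diff (h.preimage_factorAct g hA))
    · rw [← h.preimage_ae_eq_iff (h.measurableSet_factorAct g (MeasurableSet.iUnion hA))
        (MeasurableSet.iUnion fun n => h.measurableSet_factorAct g (hA n)), preimage_iUnion]
      refine (h.preimage_factorAct g (MeasurableSet.iUnion hA)).symm.trans ?_
      rw [preimage_iUnion]
      have h1 := hac.ae_eq ((α.isRegularSetIso g).map_iUnion (fun n => φ ⁻¹' A n)
        (fun n => h.measurable (hA n)) fun i j hij => (hd hij).preimage φ)
      exact h1.trans (Filter.EventuallyEq.countable_iUnion fun n => h.preimage_factorAct g (hA n))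
    · have h0 : ∀ {B : Set Ω'}, MeasurableSet B → (ν B = 0 ↔ μ.restrict E (φ ⁻¹' B) = 0) := by
        intro B hB
        simp [h.restrict_preimage hB, h.ne_zero]
      rw [h0 (h.measurableSet_factorAct g hA), h0 hA, ← measure_congr (h.preimage_factorAct g hA)]
      exact restrict_act_eq_zero_iff h.measurableSet h.act_eq g (h.measurable hA)
  act_one A hA := by
    have hac : μ.restrict E ≪ μ := Measure.restrict_le_self.absolutelyContinuous
    rw [← h.preimage_ae_eq_iff (h.measurableSet_factorAct 1 hA) hA]
    exact (h.preimage_factorAct 1 hA).symm.trans (hac.ae_eq (α.act_one _ (h.measurable hA)))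
  act_mul g k A hA := by
    have hac : μ.restrict E ≪ μ := Measure.restrict_le_self.absolutelyContinuous
    have hk := h.measurableSet_factorAct k hA
    rw [← h.preimage_ae_eq_iff (h.measurableSet_factorAct _ hA) (h.measurableSet_factorAct g hk)]
    refine (h.preimage_factorAct (g * k) hA).symm.trans
      ((hac.ae_eq (α.act_mul g k _ (h.measurable hA))).trans ?_)
    refine Filter.EventuallyEq.trans ?_ (h.preimage_factorAct g hk)
    exact act_congr_restrict h.measurableSet h.act_eq g
      (α.measurableSet_act k (h.measurable hA)) (h.measurable hk) (h.preimage_factorAct k hA)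

theorem measurableSet_act_factor (h : α.IsFactor ν E φ c) (g : G) {A : Set Ω'}
    (hA : MeasurableSet A) : MeasurableSet (h.factor.act g A) :=
  h.measurableSet_factorAct g hA

theorem preimage_act_factor (h : α.IsFactor ν E φ c) (g : G) {A : Set Ω'}
    (hA : MeasurableSet A) :
    α.act g (φ ⁻¹' A) =ᵐ[μ.restrict E] φ ⁻¹' (h.factor.act g A) :=
  h.preimage_factorAct g hA

/-- After multiplication by `c`, both measures of `A` become the integral of `d(g_*μ)/dμ` over `φ
⁻¹' A ∩ E`. -/
theorem pushforward_factor [IsFiniteMeasure μ] (h : α.IsFactor ν E φ c) (g : G)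
    {k : Ω' → ℝ≥0∞} (hk : Measurable k)
    (hkφ : (α.pushforward g).rnDeriv μ =ᵐ[μ.restrict E] k ∘ φ) :
    h.factor.pushforward g = ν.withDensity k := by
  ext A hA
  have hφA := h.measurable hA
  rw [h.factor.pushforward_apply g hA, withDensity_apply k hA]
  refine (ENNReal.mul_right_inj h.ne_zero h.ne_top).1 ?_
  rw [← h.restrict_preimage (h.measurableSet_act_factor g⁻¹ hA),
    ← measure_congr (h.preimage_act_factor g⁻¹ hA),
    Measure.restrict_apply (α.measurableSet_act g⁻¹ hφA),
    ← measure_congr (act_inter_eq h.measurableSet h.act_eq g⁻¹ hφA),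
    ← α.pushforward_apply g (hφA.inter h.measurableSet),
    ← Measure.setLIntegral_rnDeriv (α.pushforward_absolutelyContinuous g),
    ← Measure.restrict_restrict hφA,
    lintegral_congr_ae (ae_restrict_of_ae hkφ)]
  change ∫⁻ x in φ ⁻¹' A, k (φ x) ∂μ.restrict E = _
  rw [← setLIntegral_map hA hk h.measurable, h.map_eq, Measure.restrict_smul,
    lintegral_smul_measure, smul_eq_mul]

theorem density_factor [IsFiniteMeasure μ] [IsFiniteMeasure ν] (h : α.IsFactor ν E φ c) (g : G) :
    α.density g =ᵐ[μ.restrict E] h.factor.density g ∘ φ := by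
  obtain ⟨k, hk, hkφ⟩ := h.exists_rnDeriv g
  have h1 : (h.factor.pushforward g).rnDeriv ν =ᵐ[ν] k := by
    rw [h.pushforward_factor g hk hkφ]
    exact Measure.rnDeriv_withDensity ν hk
  filter_upwards [hkφ, h.ae_comp h1] with x h2 h3
  simp only [density, h2, h3, Function.comp_apply]

/-- This says that the isometries upstairs and downstairs are intertwined by pullback to `E`. Both
continuity and quasi-invariance of the factor rest on it. -/
theorem indicator_density_factor [IsFiniteMeasure μ] [IsFiniteMeasure ν]
    (h : α.IsFactor ν E φ c) (g : G) {A : Set Ω'} (hA : MeasurableSet A) :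
    (α.act g (φ ⁻¹' A ∩ E)).indicator (α.density g) =ᵐ[μ]
      E.indicator ((h.factor.act g A).indicator (h.factor.density g) ∘ φ) := by
  have h1 := (ae_restrict_iff' h.measurableSet).1 (h.density_factor g)
  have h2 := (ae_restrict_eq_iff h.measurableSet).1 (h.preimage_act_factor g hA)
  filter_upwards [h1, h2, act_inter_eq h.measurableSet h.act_eq g (h.measurable hA)]
    with x h1 h2 h3
  have h4 : x ∈ α.act g (φ ⁻¹' A ∩ E) ↔ x ∈ φ ⁻¹' (h.factor.act g A) ∩ E :=
    (iff_of_eq h3).trans (iff_of_eq h2)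
  by_cases hx : x ∈ E
  · by_cases hy : φ x ∈ h.factor.act g A
    · rw [indicator_of_mem (h4.2 ⟨hy, hx⟩), indicator_of_mem hx, Function.comp_apply,
        indicator_of_mem hy, h1 hx, Function.comp_apply]
    · rw [indicator_of_notMem (fun h' => hy (h4.1 h').1), indicator_of_mem hx,
        Function.comp_apply, indicator_of_notMem hy]
  · rw [indicator_of_notMem (fun h' => hx (h4.1 h').2), indicator_of_notMem hx]

/-- Pullback to `E` scales `L¹` distances by `c`, so orbit maps downstairs inherit continuity from
those upstairs. -/
theorem dist_koopman_factor [IsFiniteMeasure μ] [IsFiniteMeasure ν] (h : α.IsFactor ν E φ c)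
    (g k : G) {A : Set Ω'} (hA : MeasurableSet A) :
    dist (α.koopman g (indicatorConstLp 1 ((h.measurable hA).inter h.measurableSet)
          (measure_ne_top μ _) (1 : ℝ)))
        (α.koopman k (indicatorConstLp 1 ((h.measurable hA).inter h.measurableSet)
          (measure_ne_top μ _) (1 : ℝ))) =
      c.toReal * dist (h.factor.koopman g (indicatorConstLp 1 hA (measure_ne_top ν A) (1 : ℝ)))
        (h.factor.koopman k (indicatorConstLp 1 hA (measure_ne_top ν A) (1 : ℝ))) := by
  rw [L1.dist_eq_integral_dist, L1.dist_eq_integral_dist, ← smul_eq_mul,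
    ← integral_smul_measure, ← h.map_eq, integral_map h.measurable.aemeasurable,
    ← integral_indicator h.measurableSet]
  · refine integral_congr_ae ?_
    have h1 := (ae_restrict_iff' h.measurableSet).1
      (h.ae_comp (h.factor.koopman_indicator g hA))
    have h2 := (ae_restrict_iff' h.measurableSet).1
      (h.ae_comp (h.factor.koopman_indicator k hA))
    filter_upwards [α.koopman_indicator g ((h.measurable hA).inter h.measurableSet),
      α.koopman_indicator k ((h.measurable hA).inter h.measurableSet),
      h.indicator_density_factor g hA, h.indicator_density_factor k hA, h1, h2]
      with x e1 e2 e3 e4 e5 e6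
    rw [e1, e2, e3, e4]
    by_cases hx : x ∈ E
    · simp only [indicator_of_mem hx, e5 hx, e6 hx, Function.comp_apply]
    · simp only [indicator_of_notMem hx, dist_self]
  · rw [h.map_eq]
    exact ((Lp.aestronglyMeasurable _).dist (Lp.aestronglyMeasurable _)).smul_measure c

theorem isContinuous_factor [TopologicalSpace G] [IsFiniteMeasure μ] [IsFiniteMeasure ν]
    (h : α.IsFactor ν E φ c) (hα : α.IsContinuous) : h.factor.IsContinuous := by
  refine h.factor.isContinuous_of_indicator fun A hA => continuous_iff_continuousAt.2 fun k => ?_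
  have h1 := (hα (indicatorConstLp 1 ((h.measurable hA).inter h.measurableSet)
    (measure_ne_top μ _) (1 : ℝ))).tendsto k
  rw [tendsto_iff_dist_tendsto_zero] at h1
  rw [ContinuousAt, tendsto_iff_dist_tendsto_zero]
  have hc : c.toReal ≠ 0 := (ENNReal.toReal_pos h.ne_zero h.ne_top).ne'
  have h2 := h1.const_mul c.toReal⁻¹
  simp_rw [h.dist_koopman_factor _ k hA, inv_mul_cancel_left₀ hc, mul_zero] at h2
  exact h2

section VectorMeasure

variable {X : Type*} [NormedAddCommGroup X] {m : VectorMeasure Ω X}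

theorem variation_factor_le (h : α.IsFactor ν E φ c) :
    ((m.restrict E).map φ).variation ≤ (m.variation.restrict E).map φ :=
  VectorMeasure.variation_map_le.trans (Measure.map_mono VectorMeasure.variation_restrict_le
    h.measurable)

theorem variation_factor_absolutelyContinuous (h : α.IsFactor ν E φ c) (hm : m.variation ≪ μ) :
    ((m.restrict E).map φ).variation ≪ ν := by
  refine h.variation_factor_le.absolutelyContinuous.trans ?_
  refine ((hm.restrict E).map h.measurable).trans ?_
  rw [h.map_eq]
  exact Measure.smul_absolutelyContinuous

theorem variation_factor_lt_top (h : α.IsFactor ν E φ c) (hm : m.variation univ < ∞) :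
    ((m.restrict E).map φ).variation univ < ∞ := by
  refine (h.variation_factor_le univ).trans_lt ?_
  rw [Measure.map_apply h.measurable MeasurableSet.univ, preimage_univ]
  exact (Measure.restrict_apply_le E univ).trans_lt hm

theorem map_factor_apply (h : α.IsFactor ν E φ c) {A : Set Ω'} (hA : MeasurableSet A) :
    (m.restrict E).map φ A = m (φ ⁻¹' A ∩ E) := by
  rw [VectorMeasure.map_apply _ h.measurable hA,
    VectorMeasure.restrict_apply _ h.measurableSet (h.measurable hA)]

variable [NormedSpace ℝ X]

theorem isQuasiInvariant_factor [SMul G X] [IsFiniteMeasure μ] [IsFiniteMeasure ν]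
    (h : α.IsFactor ν E φ c) (hm : m.variation ≪ μ) (hq : α.IsQuasiInvariant m) :
    h.factor.IsQuasiInvariant ((m.restrict E).map φ) := by
  intro g A hA
  obtain ⟨h1, h2⟩ := hq g _ ((h.measurable hA).inter h.measurableSet)
  -- As `|m| ≪ μ`, integrands equal `μ`-almost everywhere have the same integral against `m`.
  have h3 := hm.ae_eq (h.indicator_density_factor g hA)
  set f := (h.factor.act g A).indicator (h.factor.density g) with hf
  have hfm : Measurable f := by
    refine Measurable.indicator ?_ (h.measurableSet_act_factor g hA)
    exact (Measure.measurable_rnDeriv _ _).ennreal_toReal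
  have h4 : (m.restrict E).Integrable (f ∘ φ) := by
    rw [VectorMeasure.Integrable, VectorMeasure.variation_restrict h.measurableSet]
    exact (integrable_indicator_iff h.measurableSet).1 (h1.congr h3)
  refine ⟨VectorMeasure.Integrable.map hfm.aestronglyMeasurable h4, ?_⟩
  rw [VectorMeasure.integral_map h.measurable hfm.aestronglyMeasurable h4,
    h.map_factor_apply hA, h2, VectorMeasure.integral_congr_ae h3,
    VectorMeasure.integral_indicator h.measurableSet]
  rfl

/-- If the factor has the `G`-Radon-Nikodym property, then the restriction of a quasi-invariant
vector measure to the preimages of sets of the factor has a density. -/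
theorem exists_density [TopologicalSpace G] [SMul G X] [IsFiniteMeasure μ] [IsFiniteMeasure ν]
    (h : α.IsFactor ν E φ c) (hν : HasGRNPWith G X ν) (hα : α.IsContinuous)
    (hfin : m.variation univ < ∞) (hm : m.variation ≪ μ) (hq : α.IsQuasiInvariant m) :
    ∃ f : Ω → X, Integrable f μ ∧
      ∀ A, MeasurableSet A → m (φ ⁻¹' A ∩ E) = ∫ ω in φ ⁻¹' A ∩ E, f ω ∂μ := by
  obtain ⟨f, hf, hfA⟩ := hν h.factor (h.isContinuous_factor hα) _ (h.variation_factor_lt_top hfin)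
    (h.variation_factor_absolutelyContinuous hm) (h.isQuasiInvariant_factor hm hq)
  have hf' : Integrable f ((μ.restrict E).map φ) := by
    rw [h.map_eq]
    exact hf.smul_measure h.ne_top
  have hfφ : Integrable (f ∘ φ) (μ.restrict E) :=
    (integrable_map_measure hf'.1 h.measurable.aemeasurable).1 hf'
  -- The factor `c⁻¹` compensates for `φ` mapping `μ` on `E` to `c • ν` rather than to `ν`.
  refine ⟨c.toReal⁻¹ • E.indicator (f ∘ φ),
    ((integrable_indicator_iff h.measurableSet).2 hfφ).smul _, fun A hA => ?_⟩
  have hc : c.toReal ≠ 0 := (ENNReal.toReal_pos h.ne_zero h.ne_top).ne'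
  rw [← h.map_factor_apply hA, hfA A hA]
  simp only [Pi.smul_apply]
  rw [integral_smul, setIntegral_indicator h.measurableSet, inter_assoc, inter_self,
    ← Measure.restrict_restrict (h.measurable hA)]
  simp only [Function.comp_apply]
  rw [← setIntegral_map hA hf'.1 h.measurable.aemeasurable, h.map_eq, Measure.restrict_smul,
    integral_smul_measure, smul_smul, inv_mul_cancel₀ hc, one_smul]

end VectorMeasure

end IsFactor

end RegularSetAction

/-! ### Martingale convergence in `L¹` and gluing of densities. -/

section Density

variable {Ω X : Type*} {mΩ : MeasurableSpace Ω} {μ : Measure Ω} [NormedAddCommGroup X]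

theorem integral_norm_sub_comm (f g : Ω → X) :
    ∫ x, ‖f x - g x‖ ∂μ = ∫ x, ‖g x - f x‖ ∂μ :=
  integral_congr_ae (Filter.Eventually.of_forall fun _ => norm_sub_rev _ _)

theorem integral_norm_sub_le_add {f g h : Ω → X} (hf : Integrable f μ) (hg : Integrable g μ)
    (hh : Integrable h μ) :
    ∫ x, ‖f x - h x‖ ∂μ ≤ ∫ x, ‖f x - g x‖ ∂μ + ∫ x, ‖g x - h x‖ ∂μ := by
  refine le_of_le_of_eq ?_ (integral_add (hf.sub hg).norm (hg.sub hh).norm)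
  exact integral_mono (hf.sub hh).norm ((hf.sub hg).norm.add (hg.sub hh).norm)
    fun x => norm_sub_le_norm_sub_add_norm_sub _ _ _

variable [NormedSpace ℝ X] [CompleteSpace X]

theorem integral_norm_condExp_sub_condExp_le (m : MeasurableSpace Ω) {f g : Ω → X}
    (hf : Integrable f μ) (hg : Integrable g μ) :
    ∫ x, ‖(μ[f | m]) x - (μ[g | m]) x‖ ∂μ ≤ ∫ x, ‖f x - g x‖ ∂μ := by
  refine le_trans (le_of_eq ?_) (integral_norm_condExp_le (m := m) (f - g))
  refine integral_congr_ae ?_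
  filter_upwards [condExp_sub hf hg m] with x hx
  rw [hx, Pi.sub_apply]

variable [IsFiniteMeasure μ]

/-- It reduces Lévy's theorem for vector-valued indicators to the scalar case. -/
theorem condExp_indicator_const (m : MeasurableSpace Ω) {A : Set Ω} (hA : MeasurableSet[mΩ] A)
    (c : X) : μ[A.indicator (fun _ => c) | m] =ᵐ[μ]
      fun x => (μ[A.indicator (fun _ => (1 : ℝ)) | m]) x • c := by
  have h1 : A.indicator (fun _ => c) = A.indicator (fun _ => (1 : ℝ)) • fun _ => c := by
    ext x
    by_cases hx : x ∈ A <;> simp [hx]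
  rw [h1]
  refine condExp_smul_of_aestronglyMeasurable_right ((integrable_const 1).indicator hA) ?_
    aestronglyMeasurable_const
  rw [← h1]
  exact (integrable_const c).indicator hA

/-- **Lévy's upward theorem** in `L¹` for functions with values in a Banach space. -/
theorem tendsto_integral_norm_condExp_sub (ℱ : Filtration ℕ mΩ) {f : Ω → X}
    (hf : Integrable f μ) :
    Filter.Tendsto (fun n => ∫ x, ‖(μ[f | ℱ n]) x - (μ[f | ⨆ n, ℱ n]) x‖ ∂μ) Filter.atTop
      (nhds 0) := by
  have hnn : ∀ (f : Ω → X) n, 0 ≤ ∫ x, ‖(μ[f | ℱ n]) x - (μ[f | ⨆ n, ℱ n]) x‖ ∂μ :=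
    fun f n => integral_nonneg fun x => norm_nonneg _
  refine Integrable.induction (fun f : Ω → X => Filter.Tendsto (fun n =>
    ∫ x, ‖(μ[f | ℱ n]) x - (μ[f | ⨆ n, ℱ n]) x‖ ∂μ) Filter.atTop (nhds 0)) ?_ ?_ ?_ ?_ hf
  · intro c A hA hμA
    have h1 : Filter.Tendsto (fun n => ∫ x, ‖(μ[A.indicator (fun _ => (1 : ℝ)) | ℱ n]) x -
        (μ[A.indicator (fun _ => (1 : ℝ)) | ⨆ n, ℱ n]) x‖ ∂μ) Filter.atTop (nhds 0) := by
      have h := (ENNReal.tendsto_toReal ENNReal.zero_ne_top).comp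
        (tendsto_eLpNorm_condExp (μ := μ) (ℱ := ℱ) (A.indicator (fun _ => (1 : ℝ))))
      refine h.congr fun n => ?_
      rw [Function.comp_apply, eLpNorm_one_eq_lintegral_enorm,
        ← integral_norm_eq_lintegral_enorm
          (integrable_condExp.sub integrable_condExp).aestronglyMeasurable]
      rfl
    have h2 := h1.mul_const ‖c‖
    rw [zero_mul] at h2
    refine h2.congr fun n => ?_
    rw [← integral_mul_const]
    refine integral_congr_ae ?_
    filter_upwards [condExp_indicator_const (ℱ n) hA c,
      condExp_indicator_const (⨆ n, ℱ n) hA c] with x hx hy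
    rw [hx, hy, ← sub_smul, norm_smul]
  · intro f g _ hf hg hf' hg'
    have h := hf'.add hg'
    rw [add_zero] at h
    refine squeeze_zero (hnn _) (fun n => ?_) h
    refine le_of_le_of_eq ?_ (integral_add (integrable_condExp.sub integrable_condExp).norm
      (integrable_condExp.sub integrable_condExp).norm)
    refine integral_mono_ae (integrable_condExp.sub integrable_condExp).norm
      ((integrable_condExp.sub integrable_condExp).norm.add
        (integrable_condExp.sub integrable_condExp).norm) ?_
    filter_upwards [condExp_add hf hg (ℱ n), condExp_add hf hg (⨆ n, ℱ n)] with x hx hy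
    rw [hx, hy, Pi.add_apply, Pi.add_apply, add_sub_add_comm]
    exact norm_add_le _ _
  -- An `ε / 3` argument: both conditional expectations are `L¹` contractions, so replacing `f` by
  -- `g` costs less than `ε / 3` on each side.
  · refine isClosed_of_closure_subset fun f hf => Metric.tendsto_atTop.2 fun ε hε => ?_
    obtain ⟨g, hg, hd⟩ := Metric.mem_closure_iff.1 hf (ε / 3) (by positivity)
    obtain ⟨N, hN⟩ := Metric.tendsto_atTop.1 hg (ε / 3) (by positivity)
    refine ⟨N, fun n hn => ?_⟩
    have h1 := hN n hn
    rw [Real.dist_0_eq_abs, abs_of_nonneg (hnn _ _)] at h1 ⊢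
    rw [L1.dist_eq_integral_dist] at hd
    simp_rw [dist_eq_norm] at hd
    have hfi := L1.integrable_coeFn f
    have hgi := L1.integrable_coeFn g
    have h2 := integral_norm_sub_le_add (μ := μ) (f := μ[f | ℱ n]) (g := μ[g | ℱ n])
      (h := μ[f | ⨆ n, ℱ n]) integrable_condExp integrable_condExp integrable_condExp
    have h3 := integral_norm_sub_le_add (μ := μ) (f := μ[g | ℱ n]) (g := μ[g | ⨆ n, ℱ n])
      (h := μ[f | ⨆ n, ℱ n]) integrable_condExp integrable_condExp integrable_condExp
    have h4 := integral_norm_condExp_sub_condExp_le (ℱ n) hfi hgi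
    have h5 := integral_norm_condExp_sub_condExp_le (⨆ n, ℱ n) hgi hfi
    have h6 : ∫ x, ‖g x - f x‖ ∂μ = ∫ x, ‖f x - g x‖ ∂μ := integral_norm_sub_comm _ _
    linarith
  · intro f g hfg hf hf'
    refine hf'.congr fun n => integral_congr_ae ?_
    filter_upwards [condExp_congr_ae (m := ℱ n) hfg, condExp_congr_ae (m := ⨆ n, ℱ n) hfg]
      with x hx hy
    rw [hx, hy]

/-- A set function has a density as soon as it has one on every countably generated
sub-`σ`-algebra. -/
theorem exists_density_of_forall_countable (m : Set Ω → X)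
    (H : ∀ C : Set (Set Ω), C.Countable → (∀ A ∈ C, MeasurableSet A) →
      ∃ f : Ω → X, Integrable f μ ∧
        ∀ A, MeasurableSet[MeasurableSpace.generateFrom C] A → m A = ∫ x in A, f x ∂μ) :
    ∃ f : Ω → X, Integrable f μ ∧ ∀ A, MeasurableSet A → m A = ∫ x in A, f x ∂μ := by
  let 𝒞 := {C : Set (Set Ω) // C.Countable ∧ ∀ A ∈ C, MeasurableSet A}
  let 𝓜 : 𝒞 → MeasurableSpace Ω := fun C => MeasurableSpace.generateFrom C.1
  have hle : ∀ C, 𝓜 C ≤ mΩ := fun C => MeasurableSpace.generateFrom_le C.2.2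
  choose F hF hFm using fun C : 𝒞 => H C.1 C.2.1 C.2.2
  -- Conditioning makes each density measurable for its own σ-algebra and so unique; the family
  -- becomes a martingale indexed by countable sets of generators.
  let f : 𝒞 → Ω → X := fun C => μ[F C | 𝓜 C]
  have hfi : ∀ C, Integrable (f C) μ := fun C => integrable_condExp
  have hfm : ∀ C A, MeasurableSet[𝓜 C] A → m A = ∫ x in A, f C x ∂μ := fun C A hA =>
    (hFm C A hA).trans (setIntegral_condExp (hle C) (hF C) hA).symm
  have hcond : ∀ C C' : 𝒞, C.1 ⊆ C'.1 → f C =ᵐ[μ] μ[f C' | 𝓜 C] := fun C C' hCC' => by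
    refine ae_eq_condExp_of_forall_setIntegral_eq (hle C) (hfi C')
      (fun A _ _ => (hfi C).integrableOn) (fun A hA _ => ?_)
      stronglyMeasurable_condExp.aestronglyMeasurable
    rw [← hfm C A hA, ← hfm C' A (MeasurableSpace.generateFrom_mono hCC' _ hA)]
  -- Otherwise there would be an increasing sequence whose consecutive densities stay more than `ε`
  -- apart, although they converge in `L¹` to the density for the union of the sequence.
  have hCauchy : ∀ ε : ℝ, 0 < ε → ∃ C : 𝒞, ∀ C' : 𝒞, C.1 ⊆ C'.1 →
      ∫ x, ‖f C x - f C' x‖ ∂μ ≤ ε := by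
    intro ε hε
    by_contra! hcon
    choose next hsub hnext using hcon
    let S : ℕ → 𝒞 := fun n => next^[n] ⟨∅, by simp⟩
    have hS : ∀ n, S (n + 1) = next (S n) := fun n => Function.iterate_succ_apply' _ _ _
    have hSm : Monotone fun n => (S n).1 := monotone_nat_of_le_succ fun n => by
      rw [hS]; exact hsub (S n)
    let S' : 𝒞 := ⟨⋃ n, (S n).1, countable_iUnion fun n => (S n).2.1,
      fun A hA => (mem_iUnion.1 hA).elim fun n hn => (S n).2.2 A hn⟩
    let ℱ : Filtration ℕ mΩ := ⟨fun n => 𝓜 (S n),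
      fun i j hij => MeasurableSpace.generateFrom_mono (hSm hij), fun n => hle _⟩
    have hsup : (⨆ n, ℱ n) = 𝓜 S' := MeasurableSpace.iSup_generateFrom _
    have hlim : Filter.Tendsto (fun n => ∫ x, ‖f (S n) x - f S' x‖ ∂μ) Filter.atTop
        (nhds 0) := by
      refine (tendsto_integral_norm_condExp_sub ℱ (hfi S')).congr fun n => ?_
      refine integral_congr_ae ?_
      filter_upwards [hcond (S n) S' (subset_iUnion (fun n => (S n).1) n),
        hcond S' S' subset_rfl] with x hx hy
      rw [hx, hsup, ← hy]
    obtain ⟨N, hN⟩ := Metric.tendsto_atTop.1 hlim (ε / 2) (by positivity)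
    have h1 := hN N le_rfl
    have h2 := hN (N + 1) N.le_succ
    rw [Real.dist_0_eq_abs, abs_of_nonneg (integral_nonneg fun x => norm_nonneg _)] at h1 h2
    have h3 := hnext (S N)
    rw [← hS] at h3
    have h4 := integral_norm_sub_le_add (hfi (S N)) (hfi S') (hfi (S (N + 1)))
    have h5 := integral_norm_sub_comm (μ := μ) (f S') (f (S (N + 1)))
    linarith
  have : Nonempty 𝒞 := ⟨⟨∅, by simp⟩⟩
  choose! S hS using hCauchy
  let ε : ℕ → ℝ := fun n => 1 / ((n : ℝ) + 1)
  have hε : ∀ n, 0 < ε n := fun n => Nat.one_div_pos_of_nat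
  -- A countable union is still admissible, and beyond it the densities no longer change. Adjoining
  -- any measurable `A` then shows that `f S₀` works for `A`.
  let S₀ : 𝒞 := ⟨⋃ n, (S (ε n)).1, countable_iUnion fun n => (S (ε n)).2.1,
    fun A hA => (mem_iUnion.1 hA).elim fun n hn => (S (ε n)).2.2 A hn⟩
  have hconst : ∀ C : 𝒞, S₀.1 ⊆ C.1 → f S₀ =ᵐ[μ] f C := by
    intro C hC
    have hle : ∀ n, ∫ x, ‖f S₀ x - f C x‖ ∂μ ≤ ε n + ε n := fun n => by
      have hn := subset_iUnion (fun n => (S (ε n)).1) n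
      have h1 := hS (ε n) (hε n) S₀ hn
      have h2 := hS (ε n) (hε n) C (hn.trans hC)
      have h3 := integral_norm_sub_le_add (hfi S₀) (hfi (S (ε n))) (hfi C)
      have h4 := integral_norm_sub_comm (μ := μ) (f S₀) (f (S (ε n)))
      linarith
    have h0 : ∫ x, ‖f S₀ x - f C x‖ ∂μ = 0 := by
      refine le_antisymm ?_ (integral_nonneg fun x => norm_nonneg _)
      have hlim := (tendsto_one_div_add_atTop_nhds_zero_nat (𝕜 := ℝ)).add
        (tendsto_one_div_add_atTop_nhds_zero_nat (𝕜 := ℝ))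
      rw [add_zero] at hlim
      exact ge_of_tendsto' hlim hle
    have h1 := (integral_eq_zero_iff_of_nonneg (fun x => norm_nonneg _)
      ((hfi S₀).sub (hfi C)).norm).1 h0
    filter_upwards [h1] with x hx
    exact sub_eq_zero.1 (norm_eq_zero.1 hx)
  refine ⟨f S₀, hfi S₀, fun A hA => ?_⟩
  let C : 𝒞 := ⟨insert A S₀.1, S₀.2.1.insert A, fun B hB => hB.elim (fun h => h ▸ hA) (S₀.2.2 B)⟩
  rw [hfm C A (MeasurableSpace.measurableSet_generateFrom (mem_insert A S₀.1))]
  exact integral_congr_ae (ae_restrict_of_ae (hconst C (subset_insert A S₀.1)).symm)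

end Density

/-! ### Finite measures on the line: atomless ones and unsplittable sets. -/

section RealLine

open ProbabilityTheory in
theorem continuous_cdf (P : Measure ℝ) [IsProbabilityMeasure P] [NullSingletonClass P] :
    Continuous (cdf P) := by
  refine continuous_iff_continuousAt.2 fun x => ?_
  rw [(monotone_cdf P).continuousAt_iff_leftLim_eq_rightLim, StieltjesFunction.rightLim_eq]
  refine le_antisymm ((monotone_cdf P).leftLim_le le_rfl) ?_
  have h : P {x} = 0 := measure_singleton x
  rw [← measure_cdf P, StieltjesFunction.measure_singleton, ENNReal.ofReal_eq_zero] at h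
  linarith

/-- The distribution function, with values in the unit interval. -/
noncomputable def unitCDF (P : Measure ℝ) (x : ℝ) : unitInterval :=
  ⟨ProbabilityTheory.cdf P x, ProbabilityTheory.cdf_nonneg P x, ProbabilityTheory.cdf_le_one P x⟩

theorem monotone_unitCDF (P : Measure ℝ) : Monotone (unitCDF P) :=
  fun _ _ h => ProbabilityTheory.monotone_cdf P h

theorem exists_unitCDF_eq (P : Measure ℝ) [IsProbabilityMeasure P] [NullSingletonClass P]
    {a : unitInterval} (h0 : 0 < a) (h1 : a < 1) : ∃ x, unitCDF P x = a := by
  have h0' : (0 : ℝ) < a := h0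
  have h1' : (a : ℝ) < 1 := h1
  obtain ⟨x, hx⟩ := mem_range_of_exists_le_of_exists_ge (continuous_cdf P)
    ((ProbabilityTheory.tendsto_cdf_atBot P).eventually_le_const h0').exists
    ((ProbabilityTheory.tendsto_cdf_atTop P).eventually_const_le h1').exists
  exact ⟨x, Subtype.ext hx⟩

theorem measure_Iic_eq_unitCDF (P : Measure ℝ) [IsProbabilityMeasure P] (x : ℝ) :
    P.real (Iic x) = unitCDF P x :=
  (ProbabilityTheory.cdf_eq_real P x).symm

/-- The probability integral transform. -/
theorem map_unitCDF (P : Measure ℝ) [IsProbabilityMeasure P] [NullSingletonClass P] :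
    P.map (unitCDF P) = volume := by
  have hF := (monotone_unitCDF P).measurable
  have : IsProbabilityMeasure (P.map (unitCDF P)) :=
    Measure.isProbabilityMeasure_map hF.aemeasurable
  refine Measure.ext_of_Iic _ _ fun a => ?_
  rw [Measure.map_apply hF measurableSet_Iic, unitInterval.volume_Iic]
  have key : P.real (unitCDF P ⁻¹' Iic a) = a := by
    refine le_antisymm ?_ ?_
    -- A value `b` strictly between `a` and the mass is attained at some `x`; then `{F ≤ a}` lies in
    -- `Iic x`, whose mass is only `b`.
    · by_contra! hlt
      have ha : (a : ℝ) < 1 := hlt.trans_le measureReal_le_one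
      obtain ⟨b, hab, hb⟩ := exists_between hlt
      have hb1 : b < 1 := hb.trans_le measureReal_le_one
      have hb0 : 0 < b := a.2.1.trans_lt hab
      obtain ⟨x, hx⟩ := exists_unitCDF_eq P (a := ⟨b, hb0.le, hb1.le⟩) hb0 hb1
      have h1 : unitCDF P ⁻¹' Iic a ⊆ Iic x := by
        intro y hy
        by_contra hyx
        have hxy : x < y := not_le.1 hyx
        have h2 := (monotone_unitCDF P hxy.le).trans hy
        rw [hx] at h2
        have h3 : b ≤ (a : ℝ) := h2
        exact absurd hab (not_lt.2 h3)
      have h2 := measureReal_mono (μ := P) h1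
      rw [measure_Iic_eq_unitCDF, hx] at h2
      exact absurd hb (not_lt.2 h2)
    -- The endpoints `0` and `1` are separate because the distribution function may approach them
    -- without attaining them.
    · rcases eq_or_lt_of_le a.2.1 with h0 | h0
      · rw [← h0]; exact measureReal_nonneg
      rcases eq_or_lt_of_le a.2.2 with h1 | h1
      · have : unitCDF P ⁻¹' Iic a = univ := eq_univ_of_forall fun x => by
          change (unitCDF P x : ℝ) ≤ a
          rw [h1]; exact (unitCDF P x).2.2
        rw [this, h1, probReal_univ]
      obtain ⟨x, hx⟩ := exists_unitCDF_eq P (a := a) h0 h1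
      rw [← hx, ← measure_Iic_eq_unitCDF P x, hx]
      refine measureReal_mono fun y hy => ?_
      rw [← hx]
      exact monotone_unitCDF P hy
  rw [← key, ofReal_measureReal]

/-- An atomless finite measure on the line is, up to a factor, isomorphic to Lebesgue measure on
the unit interval. -/
theorem exists_measurable_map_eq_smul_volume (ν : Measure ℝ) [IsFiniteMeasure ν]
    [NullSingletonClass ν] (hν : ν ≠ 0) :
    ∃ (F : ℝ → unitInterval) (Q : unitInterval → ℝ), Measurable F ∧ Measurable Q ∧
      ν.map F = ν univ • (volume : Measure unitInterval) ∧ ∀ᵐ x ∂ν, Q (F x) = x := by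
  have hν0 : ν univ ≠ 0 := by simpa using hν
  have hν1 : ν univ ≠ ∞ := measure_ne_top ν univ
  have : NeZero ν := ⟨hν⟩
  let P := (ν univ)⁻¹ • ν
  have hP : IsProbabilityMeasure P := inferInstance
  have hPa : NullSingletonClass P := ⟨fun x => by simp [P]⟩
  have hνP : ν = ν univ • P := by
    rw [smul_smul, ENNReal.mul_inv_cancel hν0 hν1, one_smul]
  have hF := (monotone_unitCDF P).measurable
  -- Two points with equal distribution value enclose a rational with that value. Hence removing the
  -- countably many null fibres over rationals makes the distribution function injective.
  let N : Set ℝ := ⋃ r : ℚ, unitCDF P ⁻¹' {unitCDF P r}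
  have hNm : MeasurableSet N := MeasurableSet.iUnion fun r => hF (measurableSet_singleton _)
  have hN : P N = 0 := by
    refine measure_iUnion_null fun r => ?_
    rw [← Measure.map_apply hF (measurableSet_singleton _), map_unitCDF]
    exact measure_singleton _
  have hinj : Function.Injective fun x : (Nᶜ : Set ℝ) => unitCDF P x := by
    have key : ∀ x y : ℝ, x ∉ N → x < y → unitCDF P x ≠ unitCDF P y := by
      intro x y hx hxy he
      obtain ⟨r, hr, hr'⟩ := exists_rat_btwn hxy
      refine hx (mem_iUnion.2 ⟨r, ?_⟩)
      exact le_antisymm (monotone_unitCDF P hr.le) (he ▸ monotone_unitCDF P hr'.le)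
    intro x y hxy
    rcases lt_trichotomy (x : ℝ) y with h | h | h
    · exact absurd hxy (key x y x.2 h)
    · exact Subtype.ext h
    · exact absurd hxy.symm (key y x y.2 h)
  -- By the Lusin–Souslin theorem, an injective measurable map on a standard Borel space is an
  -- embedding, so it has a measurable left inverse.
  have : StandardBorelSpace (Nᶜ : Set ℝ) := hNm.compl.standardBorel
  have hemb := (hF.comp measurable_subtype_coe).measurableEmbedding hinj
  obtain ⟨Q, hQ, hQF⟩ := hemb.exists_measurable_extend
    (measurable_subtype_coe : Measurable fun x : (Nᶜ : Set ℝ) => (x : ℝ)) fun _ => inferInstance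
  refine ⟨unitCDF P, Q, hF, hQ, ?_, ?_⟩
  · conv_lhs => rw [hνP]
    rw [Measure.map_smul, map_unitCDF]
  · have h : ∀ᵐ x ∂P, Q (unitCDF P x) = x := by
      filter_upwards [measure_eq_zero_iff_ae_notMem.1 hN] with x hx
      exact congrFun hQF ⟨x, hx⟩
    rw [hνP]
    exact (Measure.absolutelyContinuous_of_le_smul le_rfl).ae_le h

/-- A set which no measurable set splits into two parts of positive measure is concentrated on a
point. -/
theorem exists_measure_diff_singleton_eq_zero (ν : Measure ℝ) [IsFiniteMeasure ν] {D : Set ℝ}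
    (h : ∀ B, MeasurableSet B → ν (D ∩ B) = 0 ∨ ν (D ∩ Bᶜ) = 0) : ∃ y, ν (D \ {y}) = 0 := by
  by_cases hD0 : ν D = 0
  · exact ⟨0, measure_mono_null sdiff_subset hD0⟩
  -- The normalised restriction takes only the values `0` and `1`, and on the line such a
  -- probability is a Dirac mass.
  let P := (ν D)⁻¹ • ν.restrict D
  have hPB : ∀ B, MeasurableSet B → P B = (ν D)⁻¹ * ν (D ∩ B) := fun B hB => by
    simp [P, Measure.restrict_apply hB, inter_comm]
  have hcancel : (ν D)⁻¹ * ν D = 1 := ENNReal.inv_mul_cancel hD0 (measure_ne_top ν D)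
  have hP : IsZeroOneMeasure P := ⟨fun B hB => by
    rcases h B hB with h | h
    · left; rw [hPB B hB, h, mul_zero]
    · right
      rw [hPB B hB, ← hcancel, ← measure_inter_add_sdiff D hB, sdiff_eq, h, add_zero]⟩
  have hP0 : NeZero P := ⟨fun h0 => by
    have h1 := hPB univ MeasurableSet.univ
    rw [h0, inter_univ, hcancel] at h1
    simp at h1⟩
  obtain ⟨y, hy⟩ := IsZeroOneMeasure.exists_eq_dirac (μ := P)
  refine ⟨y, ?_⟩
  have h1 := hPB {y}ᶜ (measurableSet_singleton y).compl
  rw [hy, Measure.dirac_apply' _ (measurableSet_singleton y).compl] at h1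
  rw [sdiff_eq]
  simpa [measure_ne_top] using h1.symm

end RealLine

/-! ### Countably generated invariant σ-algebras. -/

section InvariantSubalgebra

theorem Subgroup.countable_closure {G : Type*} [Group G] {s : Set G} (hs : s.Countable) :
    (Subgroup.closure s : Set G).Countable := by
  have : Countable s := hs.to_subtype
  have : Countable (FreeGroup s) := inferInstanceAs (Countable (Quot _))
  have h : (Subgroup.closure s : Set G) = range (FreeGroup.lift (Subtype.val : s → G)) := by
    rw [← MonoidHom.coe_range, ← FreeGroup.closure_eq_range]
  rw [h]
  exact countable_range _

/-- A countably generated `σ`-algebra is generated by a real function. -/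
theorem exists_comap_eq_generateFrom {Ω : Type*} {C : Set (Set Ω)} (hC : C.Countable) :
    ∃ ψ : Ω → ℝ, MeasurableSpace.comap ψ inferInstance = MeasurableSpace.generateFrom C := by
  have : Countable C := hC.to_subtype
  -- The membership predicates of the countably many generators form a point of `C → Prop`, a
  -- standard Borel space that embeds in `ℝ`.
  let φ : Ω → C → Prop := fun ω A => ω ∈ A.1
  have he := measurableEmbedding_embeddingReal (C → Prop)
  refine ⟨embeddingReal (C → Prop) ∘ φ, le_antisymm ?_ ?_⟩
  · refine Measurable.comap_le ?_
    refine he.measurable.comp (@measurable_pi_iff _ _ _ (_) _ _ |>.2 fun A => ?_)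
    exact (@measurableSet_setOfPred _ (_) _).1 (MeasurableSpace.measurableSet_generateFrom A.2)
  · refine MeasurableSpace.generateFrom_le fun A hA => ?_
    refine ⟨embeddingReal (C → Prop) '' {f | f ⟨A, hA⟩}, ?_, ?_⟩
    · exact he.measurableSet_image.2 (measurableSet_setOfPred.2 (measurable_pi_apply _))
    · rw [preimage_comp, preimage_image_eq _ he.injective]
      rfl

namespace RegularSetAction

variable {G : Type*} [Group G] {Ω : Type*} {m : MeasurableSpace Ω} [mΩ : MeasurableSpace Ω]
  {μ : Measure Ω}

theorem act_empty (α : RegularSetAction G μ) (g : G) : α.act g ∅ =ᵐ[μ] (∅ : Set Ω) :=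
  ae_eq_empty.2 (α.isRegularSetIso g).measure_empty

/-- The invariance of a generated `σ`-algebra modulo null sets may be checked on generators. -/
theorem exists_act_eq_of_generateFrom (α : RegularSetAction G μ) (g : G) {C : Set (Set Ω)}
    (hCm : ∀ A ∈ C, MeasurableSet A)
    (hC : ∀ A ∈ C, ∃ B, MeasurableSet[MeasurableSpace.generateFrom C] B ∧ α.act g A =ᵐ[μ] B)
    {A : Set Ω} (hA : MeasurableSet[MeasurableSpace.generateFrom C] A) :
    ∃ B, MeasurableSet[MeasurableSpace.generateFrom C] B ∧ α.act g A =ᵐ[μ] B := by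
  have hle : MeasurableSpace.generateFrom C ≤ mΩ := MeasurableSpace.generateFrom_le hCm
  induction A, hA using MeasurableSpace.generateFrom_induction with
  | hC A hA _ => exact hC A hA
  | empty => exact ⟨∅, @MeasurableSet.empty _ (_), α.act_empty g⟩
  | compl A hA h =>
    obtain ⟨B, hB, h⟩ := h
    exact ⟨Bᶜ, hB.compl, (α.act_compl g (hle _ hA)).trans h.compl⟩
  | iUnion A hA h =>
    choose B hB h using h
    exact ⟨⋃ n, B n, .iUnion hB,
      ((α.isRegularSetIso g).map_iUnion' fun n => hle _ (hA n)).trans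
        (Filter.EventuallyEq.countable_iUnion h)⟩

variable [IsFiniteMeasure μ] [TopologicalSpace G]

/-- The function is `U_g χ_A`. The elements of `L¹` that are almost everywhere `m`-measurable form a
closed set, and `g ↦ U_g χ_A` is continuous, so membership spreads from `D` to `G`. -/
theorem aestronglyMeasurable_indicator_density (α : RegularSetAction G μ) (hα : α.IsContinuous)
    {D : Set G} (hD : Dense D) (hm : m ≤ mΩ)
    (hact : ∀ d ∈ D, ∀ A, MeasurableSet[m] A → ∃ B, MeasurableSet[m] B ∧ α.act d A =ᵐ[μ] B)
    (hdens : ∀ d ∈ D, Measurable[m] (α.density d)) (g : G) {A : Set Ω} (hA : MeasurableSet[m] A) :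
    AEStronglyMeasurable[m] ((α.act g A).indicator (α.density g)) μ := by
  have hcont := hα (indicatorConstLp 1 (hm A hA) (measure_ne_top μ A) (1 : ℝ))
  have hcl := (isClosed_aestronglyMeasurable (F := ℝ) (p := 1) (μ := μ) hm).preimage hcont
  have hall : ∀ g, AEStronglyMeasurable[m]
      (α.koopman g (indicatorConstLp 1 (hm A hA) (measure_ne_top μ A) (1 : ℝ))) μ := by
    intro g
    refine hcl.closure_subset_iff.2 (fun d hd => ?_) (hD g)
    obtain ⟨B, hB, hBA⟩ := hact d hd A hA
    refine ⟨B.indicator (α.density d), ((hdens d hd).stronglyMeasurable).indicator hB, ?_⟩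
    exact (α.koopman_indicator d (hm A hA)).trans (indicator_ae_eq_of_ae_eq_set hBA)
  exact (hall g).congr (α.koopman_indicator g (hm A hA))

theorem aestronglyMeasurable_density (α : RegularSetAction G μ) (hα : α.IsContinuous)
    {D : Set G} (hD : Dense D) (hm : m ≤ mΩ)
    (hact : ∀ d ∈ D, ∀ A, MeasurableSet[m] A → ∃ B, MeasurableSet[m] B ∧ α.act d A =ᵐ[μ] B)
    (hdens : ∀ d ∈ D, Measurable[m] (α.density d)) (g : G) :
    AEStronglyMeasurable[m] (α.density g) μ := by
  refine (α.aestronglyMeasurable_indicator_density hα hD hm hact hdens g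
    (@MeasurableSet.univ _ m)).congr ?_
  refine (indicator_ae_eq_of_ae_eq_set (α.act_univ g)).trans ?_
  rw [indicator_univ]

/-- Since the density is positive almost everywhere, `g A` is the support of `U_g χ_A`, which is
measurable for the sub-σ-algebra modulo null sets. -/
theorem exists_act_eq_of_dense (α : RegularSetAction G μ) (hα : α.IsContinuous)
    {D : Set G} (hD : Dense D) (hm : m ≤ mΩ)
    (hact : ∀ d ∈ D, ∀ A, MeasurableSet[m] A → ∃ B, MeasurableSet[m] B ∧ α.act d A =ᵐ[μ] B)
    (hdens : ∀ d ∈ D, Measurable[m] (α.density d)) (g : G) {A : Set Ω} (hA : MeasurableSet[m] A) :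
    ∃ B, MeasurableSet[m] B ∧ α.act g A =ᵐ[μ] B := by
  obtain ⟨k, hk, hkA⟩ := α.aestronglyMeasurable_indicator_density hα hD hm hact hdens g hA
  refine ⟨k ⁻¹' {0}ᶜ, hk.measurable (measurableSet_singleton 0).compl, ?_⟩
  filter_upwards [hkA, α.density_pos g] with x h1 h2
  refine propext ?_
  change x ∈ α.act g A ↔ k x ≠ 0
  rw [← h1]
  by_cases hx : x ∈ α.act g A
  · simp [hx, h2.ne']
  · simp [hx]

/-- Every countable family of sets is measurable with respect to a real function generating a
`σ`-algebra that is invariant under the action and to which all densities are adapted. -/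
theorem exists_invariant_real_map [IsTopologicalGroup G] [TopologicalSpace.SeparableSpace G]
    (α : RegularSetAction G μ) (hα : α.IsContinuous) {C : Set (Set Ω)} (hC : C.Countable)
    (hCm : ∀ A ∈ C, MeasurableSet A) :
    ∃ ψ : Ω → ℝ, Measurable ψ ∧
      MeasurableSpace.generateFrom C ≤ MeasurableSpace.comap ψ inferInstance ∧
      (∀ g B, MeasurableSet B → ∃ B', MeasurableSet B' ∧ α.act g (ψ ⁻¹' B) =ᵐ[μ] ψ ⁻¹' B') ∧
      ∀ g, ∃ k : ℝ → ℝ≥0∞, Measurable k ∧ (α.pushforward g).rnDeriv μ =ᵐ[μ] k ∘ ψ := by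
  obtain ⟨s, hsc, hsd⟩ := TopologicalSpace.exists_countable_dense G
  let D : Subgroup G := Subgroup.closure s
  have hDc : (D : Set G).Countable := Subgroup.countable_closure hsc
  have hD : Dense (D : Set G) := hsd.mono Subgroup.subset_closure
  let C₀ : Set (Set Ω) := C ∪ ⋃ d ∈ (D : Set G),
    (fun t => α.density d ⁻¹' t) '' MeasurableSpace.countableGeneratingSet ℝ
  have hdm : ∀ g, Measurable (α.density g) := fun g =>
    (Measure.measurable_rnDeriv _ _).ennreal_toReal
  have hC₀c : C₀.Countable := hC.union (hDc.biUnion fun d _ =>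
    (MeasurableSpace.countable_countableGeneratingSet (α := ℝ)).image _)
  have hC₀m : ∀ A ∈ C₀, MeasurableSet A := by
    rintro A (hA | hA)
    · exact hCm A hA
    · obtain ⟨d, hd, t, ht, rfl⟩ := mem_iUnion₂.1 hA
      exact hdm d (MeasurableSpace.measurableSet_countableGeneratingSet ht)
  -- As `D` is a subgroup, one round of translation suffices: translating a translate gives, modulo
  -- null sets, another translate of a set in `C₀`.
  let C₁ : Set (Set Ω) := C₀ ∪ ⋃ d ∈ (D : Set G), α.act d '' C₀
  have hC₁c : C₁.Countable := hC₀c.union (hDc.biUnion fun d _ => hC₀c.image _)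
  have hC₁m : ∀ A ∈ C₁, MeasurableSet A := by
    rintro A (hA | hA)
    · exact hC₀m A hA
    · obtain ⟨d, hd, B, hB, rfl⟩ := mem_iUnion₂.1 hA
      exact α.measurableSet_act d (hC₀m B hB)
  have hm : MeasurableSpace.generateFrom C₁ ≤ mΩ := MeasurableSpace.generateFrom_le hC₁m
  have hmem : ∀ d ∈ D, ∀ A ∈ C₀, α.act d A ∈ C₁ := fun d hd A hA =>
    Or.inr (mem_iUnion₂.2 ⟨d, hd, A, hA, rfl⟩)
  have hact : ∀ d ∈ (D : Set G), ∀ A, MeasurableSet[MeasurableSpace.generateFrom C₁] A →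
      ∃ B, MeasurableSet[MeasurableSpace.generateFrom C₁] B ∧ α.act d A =ᵐ[μ] B := by
    intro d hd A hA
    refine α.exists_act_eq_of_generateFrom d hC₁m ?_ hA
    rintro A (hA | hA)
    · exact ⟨_, MeasurableSpace.measurableSet_generateFrom (hmem d hd A hA),
        Filter.EventuallyEq.rfl⟩
    · obtain ⟨d', hd', B, hB, rfl⟩ := mem_iUnion₂.1 hA
      exact ⟨_, MeasurableSpace.measurableSet_generateFrom (hmem (d * d') (D.mul_mem hd hd') B hB),
        (α.act_mul d d' B (hC₀m B hB)).symm⟩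
  have hdens : ∀ d ∈ (D : Set G), Measurable[MeasurableSpace.generateFrom C₁] (α.density d) := by
    intro d hd
    have h : @Measurable Ω ℝ (MeasurableSpace.generateFrom C₁) (MeasurableSpace.generateFrom
        (MeasurableSpace.countableGeneratingSet ℝ)) (α.density d) := by
      refine @measurable_generateFrom _ _ (_) _ _ fun t ht => ?_
      exact MeasurableSpace.measurableSet_generateFrom
        (Or.inl (Or.inr (mem_iUnion₂.2 ⟨d, hd, t, ht, rfl⟩)))
    rwa [MeasurableSpace.generateFrom_countableGeneratingSet] at h
  obtain ⟨ψ, hψ⟩ := exists_comap_eq_generateFrom hC₁c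
  refine ⟨ψ, ?_, ?_, fun g B hB => ?_, fun g => ?_⟩
  · exact (measurable_iff_comap_le.2 (hψ.le.trans hm))
  · rw [hψ]
    exact MeasurableSpace.generateFrom_mono fun A hA => Or.inl (Or.inl hA)
  · have hB' : MeasurableSet[MeasurableSpace.generateFrom C₁] (ψ ⁻¹' B) := by
      rw [← hψ]; exact ⟨B, hB, rfl⟩
    obtain ⟨A, hA, hAB⟩ := α.exists_act_eq_of_dense hα hD hm hact hdens g hB'
    rw [← hψ] at hA
    obtain ⟨B', hB', rfl⟩ := hA
    exact ⟨B', hB', hAB⟩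
  · obtain ⟨f, hf, hfg⟩ := α.aestronglyMeasurable_density hα hD hm hact hdens g
    rw [← hψ] at hf
    obtain ⟨k, hk, rfl⟩ := hf.exists_eq_measurable_comp
    refine ⟨fun x => ENNReal.ofReal (k x), hk.measurable.ennreal_ofReal, ?_⟩
    filter_upwards [hfg, (α.pushforward g).rnDeriv_lt_top μ] with x h1 h2
    change _ = ENNReal.ofReal ((k ∘ ψ) x)
    rw [← h1]
    exact (ENNReal.ofReal_toReal h2.ne).symm

end RegularSetAction

end InvariantSubalgebra

/-! ### Atoms, the atomless part, and reduction to the unit interval. -/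

section Reduction

namespace MeasureTheory.VectorMeasure

variable {Ω X : Type*} [MeasurableSpace Ω] [NormedAddCommGroup X]

theorem eq_zero_of_variation_eq_zero (m : VectorMeasure Ω X) {A : Set Ω}
    (h : m.variation A = 0) : m A = 0 := by
  have h1 := enorm_measure_le_variation m A
  rw [h] at h1
  exact enorm_eq_zero.1 (le_antisymm h1 zero_le)

theorem congr_of_ae_eq {μ : Measure Ω} {m : VectorMeasure Ω X} (hm : m.variation ≪ μ)
    {A B : Set Ω} (hA : MeasurableSet A) (hB : MeasurableSet B) (h : A =ᵐ[μ] B) : m A = m B := by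
  have key : ∀ {C D : Set Ω}, MeasurableSet C → MeasurableSet D → C =ᵐ[μ] D →
      m C = m (C ∩ D) := by
    intro C D hC hD hCD
    have h1 := m.of_union (disjoint_inf_sdiff : Disjoint (C ∩ D) (C \ D))
      (hC.inter hD) (hC.diff hD)
    have h2 : m (C \ D) = 0 := eq_zero_of_variation_eq_zero m (hm (ae_eq_set.1 hCD).1)
    rw [h2, add_zero] at h1
    exact (congrArg m (inter_union_sdiff C D).symm).trans h1
  rw [key hA hB h, key hB hA h.symm, inter_comm]

variable [NormedSpace ℝ X] [CompleteSpace X]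

/-- A vector measure of bounded variation has a density on any countable set. -/
theorem exists_density_of_countable [MeasurableSingletonClass Ω] {μ : Measure Ω}
    [IsFiniteMeasure μ] {m : VectorMeasure Ω X} (hfin : m.variation univ < ∞)
    (hm : m.variation ≪ μ) {S : Set Ω} (hS : S.Countable) :
    ∃ k : Ω → X, Integrable k μ ∧ ∀ A ⊆ S, m A = ∫ x in A, k x ∂μ := by
  -- If `μ {x} = 0`, the inverse is `0` by convention; this is harmless because `|m| ≪ μ` forces `m
  -- {x} = 0`.
  let k : Ω → X := S.indicator fun x => (μ.real {x})⁻¹ • m {x}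
  have hsupp : k.support.Countable := hS.mono support_indicator_subset
  have hsmul : ∀ x ∈ S, μ.real {x} • k x = m {x} := by
    intro x hx
    simp only [k, indicator_of_mem hx]
    by_cases h0 : μ.real {x} = 0
    · rw [h0, zero_smul, eq_zero_of_variation_eq_zero m (hm ((measureReal_eq_zero_iff).1 h0))]
    · rw [smul_smul, mul_inv_cancel₀ h0, one_smul]
  have hk : AEStronglyMeasurable k μ := by
    borelize X
    refine (stronglyMeasurable_iff_measurable_separable.2 ⟨?_, ?_⟩).aestronglyMeasurable
    · refine measurable_zero.measurable_of_countable_ne (hsupp.mono fun x hx => ?_)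
      exact fun h => hx h.symm
    · refine (((hS.image k).insert 0).mono ?_).isSeparable
      rintro _ ⟨x, rfl⟩
      by_cases hx : x ∈ S
      · exact Or.inr ⟨x, hx, rfl⟩
      · exact Or.inl (indicator_of_notMem hx _)
  have hint : Integrable k μ := by
    refine ⟨hk, ?_⟩
    have h1 : ∫⁻ x, ‖k x‖ₑ ∂μ = ∫⁻ x in S, ‖k x‖ₑ ∂μ := by
      refine (setLIntegral_eq_of_support_subset ?_).symm
      intro x hx
      by_contra hxS
      exact hx (by simp [k, hxS])
    rw [HasFiniteIntegral, h1, lintegral_countable _ hS]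
    have h2 : ∑' x : S, ‖k x‖ₑ * μ {(x : Ω)} ≤ ∑' x : S, 1 * m.variation {(x : Ω)} := by
      refine ENNReal.tsum_le_tsum fun x => ?_
      rw [one_mul]
      refine le_trans (le_of_eq ?_) (enorm_measure_le_variation m {(x : Ω)})
      rw [← hsmul x x.2, enorm_smul, mul_comm, Real.enorm_of_nonneg measureReal_nonneg,
        ofReal_measureReal]
    refine h2.trans_lt ?_
    rw [← lintegral_countable (fun _ => 1) hS, setLIntegral_one]
    exact (measure_mono (subset_univ S)).trans_lt hfin
  refine ⟨k, hint, fun A hA => ?_⟩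
  have hAc : A.Countable := hS.mono hA
  rw [setIntegral_countable k hAc hint.integrableOn]
  have h1 := m.of_biUnion (s := A) (f := fun x => {x}) hAc
    (fun x _ y _ hxy => disjoint_singleton.2 hxy) fun x _ => measurableSet_singleton x
  rw [biUnion_of_singleton] at h1
  rw [h1]
  exact tsum_congr fun x => (hsmul x (hA x.2)).symm

end MeasureTheory.VectorMeasure

theorem countable_setOf_measure_singleton_ne_zero (ν : Measure ℝ) [IsFiniteMeasure ν] :
    {x | ν {x} ≠ 0}.Countable := by
  have h := Measure.countable_meas_level_set_pos (μ := ν) (g := fun x : ℝ => x) measurable_id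
  refine h.mono fun x hx => ?_
  exact pos_iff_ne_zero.2 hx

namespace RegularSetAction

variable {G : Type*} [Group G] {Ω : Type*} [MeasurableSpace Ω] {μ : Measure Ω}
  [IsFiniteMeasure μ]

/-- Write `g (ψ ⁻¹' {x})` as `ψ ⁻¹' D`. For any `B`, the set `g⁻¹ (ψ ⁻¹' B)` is some `ψ ⁻¹' B'`, and
`x` lies in `B'` or in its complement; so `D` is, modulo null sets, inside `B` or inside `Bᶜ`. Thus
`D` is concentrated on one point, which is an atom unless `D` is null. -/
theorem act_atom_le (α : RegularSetAction G μ) {ψ : Ω → ℝ} (hψ : Measurable ψ)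
    (hact : ∀ g B, MeasurableSet B → ∃ B', MeasurableSet B' ∧ α.act g (ψ ⁻¹' B) =ᵐ[μ] ψ ⁻¹' B')
    (g : G) (x : ℝ) :
    α.act g (ψ ⁻¹' {x}) ≤ᵐ[μ] ψ ⁻¹' {y | μ.map ψ {y} ≠ 0} := by
  set ν := μ.map ψ with hν
  have hx := hψ (measurableSet_singleton x)
  obtain ⟨D, hD, hDx⟩ := hact g _ (measurableSet_singleton x)
  have hsplit : ∀ B B', MeasurableSet B → MeasurableSet B' →
      α.act g⁻¹ (ψ ⁻¹' B) =ᵐ[μ] ψ ⁻¹' B' → x ∈ B' → ν (D ∩ Bᶜ) = 0 := by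
    intro B B' hB hB' hBB' hxB'
    have h1 : ψ ⁻¹' {x} ≤ᵐ[μ] α.act g⁻¹ (ψ ⁻¹' B) := by
      filter_upwards [hBB'] with ω hω hωx
      refine (iff_of_eq hω).2 ?_
      have : ψ ω = x := hωx
      change ψ ω ∈ B'
      rwa [this]
    have h2 := (α.isRegularSetIso g).mono_ae hx (α.measurableSet_act g⁻¹ (hψ hB)) h1
    rw [hν, Measure.map_apply hψ (hD.inter hB.compl), measure_eq_zero_iff_ae_notMem]
    filter_upwards [h2, hDx, α.act_act_inv g (hψ hB)] with ω h3 h4 h5 h6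
    exact h6.2 ((iff_of_eq h5).1 (h3 ((iff_of_eq h4).2 h6.1)))
  obtain ⟨y, hy⟩ := exists_measure_diff_singleton_eq_zero ν (D := D) fun B hB => by
    obtain ⟨B', hB', hBB'⟩ := hact g⁻¹ B hB
    by_cases hxB' : x ∈ B'
    · exact Or.inr (hsplit B B' hB hB' hBB' hxB')
    · left
      have h := hsplit Bᶜ B'ᶜ hB.compl hB'.compl
        ((α.act_compl g⁻¹ (hψ hB)).trans hBB'.compl) hxB'
      rwa [compl_compl] at h
  have hSm := (countable_setOf_measure_singleton_ne_zero ν).measurableSet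
  have hDS : ν (D \ {y | ν {y} ≠ 0}) = 0 := by
    by_cases hyS : ν {y} = 0
    · refine measure_mono_null (t := (D \ {y}) ∪ {y}) (fun z hz => ?_)
        (measure_union_null hy hyS)
      by_cases hzy : z = y
      · exact Or.inr hzy
      · exact Or.inl ⟨hz.1, hzy⟩
    · refine measure_mono_null (t := D \ {y}) (fun z hz => ⟨hz.1, fun hzy => hz.2 ?_⟩) hy
      have hzy' : z = y := hzy
      rw [hzy']; exact hyS
  rw [hν, Measure.map_apply hψ (hD.diff hSm), measure_eq_zero_iff_ae_notMem] at hDS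
  filter_upwards [hDS, hDx] with ω h1 h2 h3
  by_contra h4
  exact h1 ⟨(iff_of_eq h2).1 h3, h4⟩

/-- The atomless part of an invariant factor is invariant. -/
theorem act_atomless_eq (α : RegularSetAction G μ) {ψ : Ω → ℝ} (hψ : Measurable ψ)
    (hact : ∀ g B, MeasurableSet B → ∃ B', MeasurableSet B' ∧ α.act g (ψ ⁻¹' B) =ᵐ[μ] ψ ⁻¹' B')
    (g : G) : α.act g (ψ ⁻¹' {y | μ.map ψ {y} ≠ 0}ᶜ) =ᵐ[μ] ψ ⁻¹' {y | μ.map ψ {y} ≠ 0}ᶜ := by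
  have hSc := countable_setOf_measure_singleton_ne_zero (μ.map ψ)
  have hle : ∀ g, α.act g (ψ ⁻¹' {y | μ.map ψ {y} ≠ 0}) ≤ᵐ[μ]
      ψ ⁻¹' {y | μ.map ψ {y} ≠ 0} := by
    intro g
    rcases eq_empty_or_nonempty {y | μ.map ψ {y} ≠ 0} with h0 | hne
    · rw [h0, preimage_empty]
      exact (α.act_empty g).le
    obtain ⟨s, hs⟩ := hSc.exists_eq_range hne
    have h1 : ψ ⁻¹' {y | μ.map ψ {y} ≠ 0} = ⋃ n, ψ ⁻¹' {s n} := by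
      rw [hs, ← iUnion_singleton_eq_range, preimage_iUnion]
    have h2 := (α.isRegularSetIso g).map_iUnion'
      fun n => hψ (measurableSet_singleton (s n))
    rw [← h1] at h2
    filter_upwards [h2, ae_all_iff.2 fun n => α.act_atom_le hψ hact g (s n)] with ω h3 h4 h5
    obtain ⟨n, hn⟩ := mem_iUnion.1 ((iff_of_eq h3).1 h5)
    exact h4 n hn
  rw [preimage_compl]
  exact (α.act_compl g (hψ hSc.measurableSet)).trans
    (α.act_eq_of_forall_le (hψ hSc.measurableSet) hle g).compl

variable {X : Type*} [NormedAddCommGroup X] [NormedSpace ℝ X] [SMul G X] [TopologicalSpace G]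

/-- The Radon-Nikodym property of the unit interval gives densities on the atomless part of an
invariant real factor. -/
theorem exists_density_atomless (hX : HasGRNPWith G X (volume : Measure unitInterval))
    {α : RegularSetAction G μ} (hα : α.IsContinuous) {m : VectorMeasure Ω X}
    (hfin : m.variation univ < ∞) (hm : m.variation ≪ μ) (hq : α.IsQuasiInvariant m)
    {ψ : Ω → ℝ} (hψ : Measurable ψ)
    (hact : ∀ g B, MeasurableSet B → ∃ B', MeasurableSet B' ∧ α.act g (ψ ⁻¹' B) =ᵐ[μ] ψ ⁻¹' B')
    (hrn : ∀ g, ∃ k : ℝ → ℝ≥0∞, Measurable k ∧ (α.pushforward g).rnDeriv μ =ᵐ[μ] k ∘ ψ)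
    {S : Set ℝ} (hS : MeasurableSet S) (hSE : ∀ g, α.act g (ψ ⁻¹' S) =ᵐ[μ] ψ ⁻¹' S)
    (hSa : ∀ y ∈ S, μ.map ψ {y} = 0) :
    ∃ f : Ω → X, Integrable f μ ∧ ∀ B, MeasurableSet B →
      m (ψ ⁻¹' B ∩ ψ ⁻¹' S) = ∫ ω in ψ ⁻¹' B ∩ ψ ⁻¹' S, f ω ∂μ := by
  have hE : MeasurableSet (ψ ⁻¹' S) := hψ hS
  set ν := (μ.map ψ).restrict S with hν
  have hνE : ν = (μ.restrict (ψ ⁻¹' S)).map ψ := Measure.restrict_map hψ hS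
  -- A null atomless part is treated apart, since the normalising factor `ν univ` must not vanish.
  by_cases h0 : ν = 0
  · refine ⟨0, integrable_zero _ _ _, fun B hB => ?_⟩
    have h1 : μ (ψ ⁻¹' S) = 0 := by
      rw [← Measure.map_apply hψ hS, ← Measure.restrict_apply_univ, ← hν, h0]
      simp
    rw [VectorMeasure.eq_zero_of_variation_eq_zero m (hm (measure_mono_null inter_subset_right h1))]
    simp
  have hνa : NullSingletonClass ν := ⟨fun y => by
    rw [hν, Measure.restrict_apply (measurableSet_singleton y)]
    by_cases hy : y ∈ S
    · exact measure_mono_null inter_subset_left (hSa y hy)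
    · rw [singleton_inter_eq_empty.2 hy, measure_empty]⟩
  obtain ⟨F, Q, hF, hQ, hmap, hQF⟩ := exists_measurable_map_eq_smul_volume ν h0
  have hQψ : ∀ᵐ ω ∂μ.restrict (ψ ⁻¹' S), Q (F (ψ ω)) = ψ ω := by
    rw [hνE] at hQF
    exact ae_of_ae_map hψ.aemeasurable hQF
  -- Nothing is lost in passing to the interval: through the left inverse `Q`, every set measurable
  -- for `ψ` is, modulo null sets on the atomless part, measurable for `F ∘ ψ`.
  have hpre : ∀ B : Set ℝ, (ψ ⁻¹' B : Set Ω) =ᵐ[μ.restrict (ψ ⁻¹' S)] (F ∘ ψ) ⁻¹' (Q ⁻¹' B) := by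
    intro B
    filter_upwards [hQψ] with ω hω
    change (ψ ω ∈ B) = (Q (F (ψ ω)) ∈ B)
    rw [hω]
  have hfac : α.IsFactor (volume : Measure unitInterval) (ψ ⁻¹' S) (F ∘ ψ) (ν univ) :=
    { measurableSet := hE
      measurable := hF.comp hψ
      act_eq := hSE
      ne_zero := by simpa using h0
      ne_top := measure_ne_top ν univ
      map_eq := by rw [← Measure.map_map hF hψ, ← hνE, hmap]
      exists_act := fun g A hA => by
        obtain ⟨B, hB, hAB⟩ := hact g (F ⁻¹' A) (hF hA)
        exact ⟨Q ⁻¹' B, hQ hB,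
          (Measure.restrict_le_self.absolutelyContinuous.ae_eq hAB).trans (hpre B)⟩
      exists_rnDeriv := fun g => by
        obtain ⟨k, hk, hkg⟩ := hrn g
        refine ⟨k ∘ Q, hk.comp hQ, ?_⟩
        filter_upwards [ae_restrict_of_ae hkg, hQψ] with ω h1 h2
        simp only [h1, Function.comp_apply, h2] }
  obtain ⟨f, hf, hfA⟩ := hfac.exists_density hX hα hfin hm hq
  refine ⟨f, hf, fun B hB => ?_⟩
  have h1 := (ae_restrict_eq_iff hE).1 (hpre B)
  rw [VectorMeasure.congr_of_ae_eq hm ((hψ hB).inter hE)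
    (((hF.comp hψ) (hQ hB)).inter hE) h1, hfA _ (hQ hB)]
  exact setIntegral_congr_set h1.symm

/-- The density is glued from the interval's density on the atomless part of `ψ` and the quotient of
point masses on its countably many atoms. -/
theorem exists_density_on_generateFrom [CompleteSpace X] [IsTopologicalGroup G]
    [TopologicalSpace.SeparableSpace G]
    (hX : HasGRNPWith G X (volume : Measure unitInterval))
    {α : RegularSetAction G μ} (hα : α.IsContinuous) {m : VectorMeasure Ω X}
    (hfin : m.variation univ < ∞) (hm : m.variation ≪ μ) (hq : α.IsQuasiInvariant m)
    {C : Set (Set Ω)} (hC : C.Countable) (hCm : ∀ A ∈ C, MeasurableSet A) :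
    ∃ f : Ω → X, Integrable f μ ∧
      ∀ A, MeasurableSet[MeasurableSpace.generateFrom C] A → m A = ∫ ω in A, f ω ∂μ := by
  obtain ⟨ψ, hψ, hCψ, hact, hrn⟩ := α.exists_invariant_real_map hα hC hCm
  set S : Set ℝ := {y | μ.map ψ {y} ≠ 0} with hS
  have hSc : S.Countable := countable_setOf_measure_singleton_ne_zero (μ.map ψ)
  have hSm := hSc.measurableSet
  obtain ⟨f, hf, hfB⟩ := exists_density_atomless hX hα hfin hm hq hψ hact hrn hSm.compl
    (α.act_atomless_eq hψ hact) fun y hy => not_not.1 hy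
  have hfin' : (m.map ψ).variation univ < ∞ := by
    refine (VectorMeasure.variation_map_le univ).trans_lt ?_
    rwa [Measure.map_apply hψ MeasurableSet.univ, preimage_univ]
  obtain ⟨k, hk, hkB⟩ := VectorMeasure.exists_density_of_countable hfin'
    (VectorMeasure.variation_map_le.absolutelyContinuous.trans (hm.map hψ)) hSc
  have hkψ : Integrable (k ∘ ψ) μ := (integrable_map_measure hk.1 hψ.aemeasurable).1 hk
  have hE : MeasurableSet (ψ ⁻¹' Sᶜ) := hψ hSm.compl
  refine ⟨(ψ ⁻¹' Sᶜ).indicator f + (ψ ⁻¹' S).indicator (k ∘ ψ),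
    (hf.indicator hE).add (hkψ.indicator (hψ hSm)), fun A hA => ?_⟩
  obtain ⟨B, hB, rfl⟩ := hCψ A hA
  have h1 : m (ψ ⁻¹' B) = m (ψ ⁻¹' B ∩ ψ ⁻¹' Sᶜ) + m (ψ ⁻¹' (B ∩ S)) := by
    rw [← m.of_union _ ((hψ hB).inter hE) (hψ (hB.inter hSm))]
    · rw [← preimage_inter, ← preimage_union, union_comm, inter_union_compl]
    · rw [← preimage_inter]
      exact (disjoint_compl_left.mono inter_subset_right inter_subset_right).preimage ψ
  have h2 : m (ψ ⁻¹' (B ∩ S)) = ∫ ω in ψ ⁻¹' (B ∩ S), k (ψ ω) ∂μ := by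
    rw [← VectorMeasure.map_apply m hψ (hB.inter hSm), hkB _ inter_subset_right,
      setIntegral_map (hB.inter hSm) hk.1 hψ.aemeasurable]
  simp only [Pi.add_apply]
  rw [h1, integral_add (hf.indicator hE).integrableOn (hkψ.indicator (hψ hSm)).integrableOn,
    setIntegral_indicator hE, setIntegral_indicator (hψ hSm), hfB B hB, h2]
  rfl

end RegularSetAction

/-- The `G`-Radon-Nikodym property of the unit interval implies that of every finite measure
space. -/
theorem HasGRNPWith.of_unitInterval {G X : Type*} [Group G] [TopologicalSpace G]
    [IsTopologicalGroup G] [TopologicalSpace.SeparableSpace G] [NormedAddCommGroup X]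
    [NormedSpace ℝ X] [CompleteSpace X] [SMul G X]
    (hX : HasGRNPWith G X (volume : Measure unitInterval)) {Ω : Type*} [MeasurableSpace Ω]
    (μ : Measure Ω) [IsFiniteMeasure μ] : HasGRNPWith G X μ :=
  fun _ hα m hfin hm hq => exists_density_of_forall_countable m fun _ hC hCm =>
    RegularSetAction.exists_density_on_generateFrom hX hα hfin hm hq hC hCm

/-- The `G`-Radon-Nikodym property is invariant under isomorphism of measure spaces. -/
theorem HasGRNPWith.of_measurableEquiv {G X : Type*} [Group G] [TopologicalSpace G]
    [NormedAddCommGroup X] [NormedSpace ℝ X] [SMul G X] {Ω Ω' : Type*} [MeasurableSpace Ω]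
    [MeasurableSpace Ω'] {μ : Measure Ω} [IsFiniteMeasure μ] (e : Ω ≃ᵐ Ω')
    (h : HasGRNPWith G X (μ.map e)) : HasGRNPWith G X μ := by
  intro α hα m hfin hm hq
  -- An isomorphism is a factor map defined on the whole space, with factor `1`.
  have hfac : α.IsFactor (μ.map e) univ e 1 :=
    { measurableSet := MeasurableSet.univ
      measurable := e.measurable
      act_eq := α.act_univ
      ne_zero := one_ne_zero
      ne_top := ENNReal.one_ne_top
      map_eq := by rw [Measure.restrict_univ, one_smul]
      exists_act := fun g A hA => by
        refine ⟨e.symm ⁻¹' α.act g (e ⁻¹' A),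
          e.symm.measurable (α.measurableSet_act g (e.measurable hA)), ?_⟩
        rw [← preimage_comp, MeasurableEquiv.symm_comp_self, preimage_id]
        exact Filter.EventuallyEq.rfl
      exists_rnDeriv := fun g => by
        refine ⟨_, (Measure.measurable_rnDeriv (α.pushforward g) μ).comp e.symm.measurable, ?_⟩
        rw [Function.comp_assoc, MeasurableEquiv.symm_comp_self, Function.comp_id] }
  obtain ⟨f, hf, hfA⟩ := hfac.exists_density h hα hfin hm hq
  refine ⟨f, hf, fun A hA => ?_⟩
  have h1 := hfA _ (e.symm.measurable hA)
  rwa [← preimage_comp, MeasurableEquiv.symm_comp_self, preimage_id, inter_univ] at h1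

end Reduction

theorem mainTheorem6 (G : Type u) [Group G] [TopologicalSpace G] [IsTopologicalGroup G]
    [T2Space G] [LocallyCompactSpace G] [SigmaCompactSpace G] [TopologicalSpace.SeparableSpace G]
    (X : Type v) [NormedAddCommGroup X] [NormedSpace ℝ X] [CompleteSpace X]
    [DistribMulAction G X] [SMulCommClass G ℝ X] [IsIsometricSMul G X] [ContinuousSMul G X] :
    HasGRNP.{w} G X ↔ HasGRNPWith G X (volume : Measure unitInterval) := by
  refine ⟨fun h => ?_, fun h Ω _ μ _ => h.of_unitInterval μ⟩
  -- The lift only moves the interval into the universe over which `HasGRNP` quantifies.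
  exact HasGRNPWith.of_measurableEquiv MeasurableEquiv.ulift.symm
    (h (ULift.{w} unitInterval) _)
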